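/- Let $\mathcal X,\mathcal Y,\mathcal Z$ be finite sets, $p_{XY}$ a p.m.f. on $\mathcal X\times\mathcal Y$, and for every $(x,y)$ let $p_{Z|XY}(\cdot|x,y)$ be a p.m.f. on $\mathcal Z$. **The relation $\equiv$.** For distinct $x,x'\in\mathcal X$ write $x\sim x'$ if there are $y\in\mathcal Y$, $z\in\mathcal Z$ with $p_{XY}(x,y)>0$, $p_{XY}(x',y)>0$, $p_{Z|XY}(z|x,y)>0$ and $p_{Z|XY}(z|x',y)>0$. Let $\equiv$ be the equivalence relation on $\mathcal X$ in which $x\equiv x'$ iff $x=x'$ or $x$ and $x'$ are joined by a finite chain of $\sim$-steps, and let $\mathcal X=\mathcal X_1\uplus\dots\uplus\mathcal X_k$ be its partition into classes. For $C\subseteq\mathcal X$, $D\subseteq\mathcal Y$, the block $C\times D$ is *column monochromatic* if for all $y\in D$ and all distinct $x,x'\in C$ with $p_{XY}(x,y)>0$ and $p_{XY}(x',y)>0$ one has $p_{Z|XY}(z|x,y)=p_{Z|XY}(z|x',y)$ for all $z\in\mathcal Z$. **Protocols.** Alice and Bob hold inputs and sources of private randomness (arbitrary probability spaces), independent of each other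 and of the inputs, and exchange binary messages over multiple rounds. In each round one user speaks; who speaks, whether the communication is over, and the prefix-free code that contains the next message are determined by the messages exchanged so far. The message is a function of the speaker's input, private randomness and the messages so far. For every pair of inputs the communication ends after finitely many rounds almost surely. $M$ denotes the transcript (all messages exchanged), $|M|$ its length in bits. At the end Bob outputs a function of his input, his private randomness and $M$. **Perfect security.** $(p_{XY},p_{Z|XY})$ is computable with perfect security if there is a protocol which, on inputs $(X,Y)\sim p_{XY}$, gives Bob an output $Z$ with conditional law $p_{Z|XY}$ (for all $(x,y)$ with $p_{XY}(x,y)>0$) such that $M-X-(Y,Z)$ and $M-(Y,Z)-X$ are Markov chains. **Asymptotic security.** Let $(X_i,Y_i)$ be i.i.d. $\sim p_{XY}$ and $p_{Z^n|X^nY^n}=\prod_{i=1}^n p_{Z|XY}(z_i|x_i,y_i)$. A protocol with inputs $X^n$, $Y^n$ in which Bob outputs $\hat Z^n\in\mathcal Z^n$ is called $\epsilon$-secure if $$\mathbb E_{X^nY^n}\|p_{\hat Z^n|X^nY^n}-p_{Z^n|X^nY^n}\|_1\le\epsilon,\qquad I(M;Y^n,\hat Z^n|X^n)\le n\epsilon,\qquad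 I(M;X^n|Y^n,\hat Z^n)\le n\epsilon .$$ $(p_{XY},p_{Z|XY})$ is computable with asymptotic security if for every $\epsilon>0$ there are arbitrarily large $n$ for which an $\epsilon$-secure protocol on blocks of length $n$ exists. A rate $R\in[0,\infty)$ is achievable if there is a sequence of protocols $\Pi_n$ on blocks of length $n$ with $\frac1n\mathbb E|M|\to R$ such that for every $\epsilon>0$, $\Pi_n$ is $\epsilon$-secure for all sufficiently large $n$. **Theorem.** The following are equivalent: 1. $(p_{XY},p_{Z|XY})$ is computable with asymptotic security; 2. some rate $R\in[0,\infty)$ is achievable; 3. each $\mathcal X_i\times\mathcal Y$, $i\in\{1,\dots,k\}$, is column monochromatic; 4. $(p_{XY},p_{Z|XY})$ is computable with perfect security. -/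

import Mathlib

open MeasureTheory Filter Topology

noncomputable section

/-! ### The two-user computation problem -/

/-- A problem `(p_XY, p_{Z|XY})`: a joint p.m.f. of the inputs and, for every pair of inputs,
a p.m.f. of the output. -/
structure Problem (X Y Z : Type*) [Fintype X] [Fintype Y] [Fintype Z] where
  /-- `pXY x y` is the probability of the input pair `(x, y)`. -/
  pXY : X → Y → ℝ
  /-- `pZ x y z` is the conditional probability of the output `z` given `(x, y)`. -/
  pZ : X → Y → Z → ℝ
  pXY_nonneg : ∀ x y, 0 ≤ pXY x y
  pXY_sum : ∑ x, ∑ y, pXY x y = 1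
  pZ_nonneg : ∀ x y z, 0 ≤ pZ x y z
  pZ_sum : ∀ x y, ∑ z, pZ x y z = 1

namespace Problem

variable {X Y Z : Type*} [Fintype X] [Fintype Y] [Fintype Z]

/-- The problem formed by `n` i.i.d. copies: inputs `X^n`, `Y^n`, output `Z^n`. -/
def block (P : Problem X Y Z) (n : ℕ) :
    Problem (Fin n → X) (Fin n → Y) (Fin n → Z) where
  pXY x y := ∏ i, P.pXY (x i) (y i)
  pZ x y z := ∏ i, P.pZ (x i) (y i) (z i)
  pXY_nonneg _ _ := Finset.prod_nonneg fun _ _ => P.pXY_nonneg _ _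
  pXY_sum := by
    classical
    have h : ∀ x : Fin n → X, ∑ y : Fin n → Y, ∏ i, P.pXY (x i) (y i)
        = ∏ i, ∑ b, P.pXY (x i) b := fun x => by
      rw [Finset.prod_univ_sum, Fintype.piFinset_univ]
    simp_rw [h]
    have h2 := Finset.prod_univ_sum (fun _ : Fin n => (Finset.univ : Finset X))
      (fun _ a => ∑ b, P.pXY a b)
    rw [Fintype.piFinset_univ] at h2
    rw [← h2]
    simp [P.pXY_sum]
  pZ_nonneg _ _ _ := Finset.prod_nonneg fun _ _ => P.pZ_nonneg _ _ _
  pZ_sum x y := by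
    classical
    have h2 := Finset.prod_univ_sum (fun _ : Fin n => (Finset.univ : Finset Z))
      (fun i c => P.pZ (x i) (y i) c)
    rw [Fintype.piFinset_univ] at h2
    rw [← h2]
    simp [P.pZ_sum]

/-- `x ∼ x'`: distinct, and some `y`, `z` are jointly possible with both of them. -/
def Confusable (P : Problem X Y Z) (x x' : X) : Prop :=
  x ≠ x' ∧ ∃ y z, 0 < P.pXY x y ∧ 0 < P.pXY x' y ∧ 0 < P.pZ x y z ∧ 0 < P.pZ x' y z

/-- The equivalence relation `≡`: being connected by a finite chain of `∼`-steps. -/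
def chainSetoid (P : Problem X Y Z) : Setoid X where
  r := Relation.ReflTransGen P.Confusable
  iseqv :=
    { refl := fun _ => Relation.ReflTransGen.refl
      symm := fun h => by
        have hs : ∀ a b, P.Confusable a b → P.Confusable b a := by
          rintro a b ⟨hne, y, z, h1, h2, h3, h4⟩
          exact ⟨hne.symm, y, z, h2, h1, h4, h3⟩
        induction h with
        | refl => exact Relation.ReflTransGen.refl
        | tail _ hbc ih => exact Relation.ReflTransGen.head (hs _ _ hbc) ih
      trans := fun h h' => h.trans h' }

/-- `C × D` is column monochromatic. -/
def ColumnMonochromatic (P : Problem X Y Z) (C : Set X) (D : Set Y) : Prop :=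
  ∀ y ∈ D, ∀ x ∈ C, ∀ x' ∈ C, x ≠ x' → 0 < P.pXY x y → 0 < P.pXY x' y →
    ∀ z, P.pZ x y z = P.pZ x' y z

end Problem

/-! ### Protocols -/

/-- The two users. -/
inductive Party
  | alice
  | bob

/-- A message is a binary string. -/
abbrev Message := List Bool

/-- A (partial or complete) transcript: the messages exchanged so far, in chronological order. -/
abbrev Transcript := List Message

/-- The transcript after at most `k` rounds. `turn h` says who speaks after the messages `h`
(`none`: the communication is over), `f` and `g` are the next-message functions of Alice and
Bob with their inputs and private randomness plugged in. -/
def transcriptAfter (turn : Transcript → Option Party) (f g : Transcript → Message) :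
    ℕ → Transcript
  | 0 => []
  | k + 1 =>
    let h := transcriptAfter turn f g k
    match turn h with
    | none => h
    | some Party.alice => h ++ [f h]
    | some Party.bob => h ++ [g h]

/-- An interactive protocol with private randomness; Alice's input is in `A`, Bob's input is in
`B`, Bob's output is in `C`. The users' sources of private randomness are arbitrary probability
spaces. Whose turn it is, whether the communication is over, and the prefix-free code that the
next message belongs to are determined by the messages exchanged so far. -/
structure Protocol (A B C : Type*) where
  /-- Alice's private randomness. -/
  ΩA : Type
  /-- Bob's private randomness. -/
  ΩB : Type
  [measurableSpaceA : MeasurableSpace ΩA]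
  [measurableSpaceB : MeasurableSpace ΩB]
  μA : Measure ΩA
  μB : Measure ΩB
  [isProbA : IsProbabilityMeasure μA]
  [isProbB : IsProbabilityMeasure μB]
  turn : Transcript → Option Party
  code : Transcript → Set Message
  /-- Alice's next-message function. -/
  msgA : A → ΩA → Transcript → Message
  /-- Bob's next-message function. -/
  msgB : B → ΩB → Transcript → Message
  /-- Bob's output function. -/
  out : B → ΩB → Transcript → C
  code_prefixFree : ∀ h, ∀ u ∈ code h, ∀ v ∈ code h, u <+: v → u = v
  msgA_mem : ∀ a r h, turn h = some Party.alice → msgA a r h ∈ code h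
  msgB_mem : ∀ b r h, turn h = some Party.bob → msgB b r h ∈ code h
  msgA_measurable : ∀ a h u, MeasurableSet {r | msgA a r h = u}
  msgB_measurable : ∀ b h u, MeasurableSet {r | msgB b r h = u}
  out_measurable : ∀ b h c, MeasurableSet {r | out b r h = c}
  /-- On every pair of inputs the communication ends after finitely many rounds, almost surely. -/
  halts : ∀ a b, ∀ᵐ r ∂(μA.prod μB),
    ∃ k, turn (transcriptAfter turn (msgA a r.1) (msgB b r.2) k) = none

namespace Protocol

attribute [instance] Protocol.measurableSpaceA Protocol.measurableSpaceB
  Protocol.isProbA Protocol.isProbB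

variable {A B C : Type*}

/-- `p(m, ẑ | a, b)`: the probability that on the inputs `a`, `b` the complete transcript is `m`
and Bob outputs `c`. The two sources of private randomness are independent of each other and of
the inputs. -/
def law (prot : Protocol A B C) (a : A) (b : B) (m : Transcript) (c : C) : ℝ :=
  (prot.μA.prod prot.μB).real
    {r | prot.turn m = none ∧
      (∃ k, transcriptAfter prot.turn (prot.msgA a r.1) (prot.msgB b r.2) k = m) ∧
      prot.out b r.2 m = c}

/-- `p(ẑ | a, b)`: the distribution of Bob's output on the inputs `a`, `b`. -/
def outLaw (prot : Protocol A B C) (a : A) (b : B) (c : C) : ℝ :=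
  ∑' m, prot.law a b m c

end Protocol

/-! ### Information measures

Joint distributions are given by their p.m.f.s. -/

section Information

/-- `H(U | V) = ∑ᵥ p(v) H(U | V = v)` (natural logarithm), where `U` takes finitely many values
and `V` countably many. -/
def condEntropy {U V : Type*} [Fintype U] (q : U → V → ℝ) : ℝ :=
  ∑' v, (∑ u, q u v) * ∑ u, Real.negMulLog (q u v / ∑ u', q u' v)

/-- `I(V ; U | W) = H(U | W) - H(U | V, W)`, where `V` takes countably many values. -/
def condMutualInfo {V U W : Type*} [Fintype U] (q : V → U → W → ℝ) : ℝ :=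
  condEntropy (fun u w => ∑' v, q v u w) - condEntropy (fun u (vw : V × W) => q vw.1 u vw.2)

/-- The Markov chain `U - V - W`, i.e. `p(u, v, w) p(v) = p(u, v) p(v, w)`. -/
def MarkovChain {U V W : Type*} (q : U → V → W → ℝ) : Prop :=
  ∀ u v w, q u v w * (∑' u', ∑' w', q u' v w') = (∑' w', q u v w') * (∑' u', q u' v w)

end Information

/-! ### Security -/

namespace Protocol

variable {A B C : Type*} [Fintype A] [Fintype B] [Fintype C]

/-- The joint p.m.f. of `(X, Y, M, Ẑ)` when the inputs are drawn according to the problem. -/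
def joint (prot : Protocol A B C) (P : Problem A B C) (a : A) (b : B) (m : Transcript) (c : C) : ℝ :=
  P.pXY a b * prot.law a b m c

/-- The expected `L¹`-distance between the actual and the desired conditional output law. -/
def error (prot : Protocol A B C) (P : Problem A B C) : ℝ :=
  ∑ a, ∑ b, P.pXY a b * ∑ c, |prot.outLaw a b c - P.pZ a b c|

/-- `I(M ; Y, Ẑ | X)`. -/
def leakAlice (prot : Protocol A B C) (P : Problem A B C) : ℝ :=
  condMutualInfo fun (m : Transcript) (bc : B × C) (a : A) => prot.joint P a bc.1 m bc.2

/-- `I(M ; X | Y, Ẑ)`. -/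
def leakBob (prot : Protocol A B C) (P : Problem A B C) : ℝ :=
  condMutualInfo fun (m : Transcript) (a : A) (bc : B × C) => prot.joint P a bc.1 m bc.2

/-- `𝔼[|M|]`, the expected number of transmitted bits. -/
def expectedLength (prot : Protocol A B C) (P : Problem A B C) : ENNReal :=
  ∑' m : Transcript, ∑ a, ∑ b, ∑ c, ENNReal.ofReal (prot.joint P a b m c) * (m.flatten.length : ENNReal)

/-- The protocol computes the problem with perfect security: the output has the desired law, and
`M - X - (Y, Z)` and `M - (Y, Z) - X` are Markov chains. -/
def PerfectlySecure (prot : Protocol A B C) (P : Problem A B C) : Prop :=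
  (∀ a b, 0 < P.pXY a b → ∀ c, prot.outLaw a b c = P.pZ a b c) ∧
  MarkovChain (fun (m : Transcript) (a : A) (bc : B × C) => prot.joint P a bc.1 m bc.2) ∧
  MarkovChain (fun (m : Transcript) (bc : B × C) (a : A) => prot.joint P a bc.1 m bc.2)

end Protocol

namespace Problem

variable {X Y Z : Type*} [Fintype X] [Fintype Y] [Fintype Z]

/-- Some protocol computes the problem with perfect security. -/
def PerfectlyComputable (P : Problem X Y Z) : Prop :=
  ∃ prot : Protocol X Y Z, prot.PerfectlySecure P

/-- The protocol `prot` for blocks of length `n` has error at most `ε` and leaks at most `n ε`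
to either user. -/
def SecureUpTo (P : Problem X Y Z) (n : ℕ) (ε : ℝ)
    (prot : Protocol (Fin n → X) (Fin n → Y) (Fin n → Z)) : Prop :=
  prot.error (P.block n) ≤ ε ∧
  prot.leakAlice (P.block n) ≤ n * ε ∧
  prot.leakBob (P.block n) ≤ n * ε

/-- The problem is computable with asymptotic security: for every `ε > 0` there are an
arbitrarily large `n` and a protocol for blocks of length `n` that is secure up to `ε`. -/
def AsymptoticallyComputable (P : Problem X Y Z) : Prop :=
  ∀ ε : ℝ, 0 < ε → ∀ n₀ : ℕ, ∃ n ≥ n₀,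
    ∃ prot : Protocol (Fin n → X) (Fin n → Y) (Fin n → Z), P.SecureUpTo n ε prot

/-- The rate `R` (bits per symbol) is achievable with asymptotic security: there is a sequence
of protocols of rate `R` that, for every `ε > 0`, are eventually secure up to `ε`. -/
def AchievableRate (P : Problem X Y Z) (R : NNReal) : Prop :=
  ∃ prot : ∀ n : ℕ, Protocol (Fin n → X) (Fin n → Y) (Fin n → Z),
    Tendsto (fun n : ℕ => (prot n).expectedLength (P.block n) / (n : ENNReal)) atTop
      (𝓝 (R : ENNReal)) ∧
    ∀ ε : ℝ, 0 < ε → ∀ᶠ n : ℕ in atTop, P.SecureUpTo n ε (prot n)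

end Problem

end

/-! The easy half is a one-message protocol (`oneMessage`). Alice sends the class of her input, and
Bob samples from the law of any input pair compatible with that class and with `y`. Column
monochromaticity makes the output law right. The message is a function of `x`, and on the support it
is also a function of `(y, z)`, because inputs compatible with the same `(y, z)` are confusable.
Nothing leaks, and coordinatewise encoding gives a finite rate.

The converse rests on the rectangle property `exists_law_eq_mul`: the probability of a transcript
and output splits into Alice's factor times Bob's. Suppose a variable `u` has joint law `p(x,y)
A(u,x) B(u,y,z)`, is nearly independent of `(y,z)` given `x`, with conditional law `g x`, and is
nearly independent of `x` given `(y,z)`, with conditional law `h y z`. Confusable inputs share a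
possible `(y,z)`, so their `g` are both close to `h y z`, and `g` is nearly constant along chains.
For two inputs in one class that are compatible with `y`, this makes `A(u,x) ∑ B` and `A(u,x') ∑ B`
close. Since `B ≤ ∑ B`, also `A(u,x) B` and `A(u,x') B` are close, and summing over `u` equates the
output laws in the limit (`columnMonochromatic_of_almostSecure`).

Under perfect security `u` is the transcript. For blocks it is `(M, X_{<i}, Y_{>i})`, which keeps
the product form (`push_pastFuture`). The chain rule for `I(M; Yⁿ, Zⁿ | Xⁿ)` is run from the last
coordinate and that for `I(M; Xⁿ | Yⁿ, Zⁿ)` from the first, so both conditionings contain `X_{<i}`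
and `Y_{>i}`. Some coordinate has small increments in both. Data processing with a Hellinger
remainder (`sum_sq_sqrt_sub_le_relEntropy_sub`) turns them into `L¹` bounds, and closeness of the
word law to the i.i.d. one decouples the coordinate from the rest (`exists_coarse_approx`). -/

noncomputable section

/-! ### Push-forwards, relative entropy and data processing -/

open scoped Classical in
/-- The push-forward of a finite mass function along a map. -/
def push {α β : Type*} [Fintype α] (T : α → β) (a : α → ℝ) (s : β) : ℝ :=
  ∑ t, if T t = s then a t else 0

/-- The (unnormalised) relative entropy of two finite mass functions. -/
def relEntropy {α : Type*} [Fintype α] (a b : α → ℝ) : ℝ :=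
  ∑ t, a t * Real.log (a t / b t)

section Push

variable {α β γ : Type*} [Fintype α]

lemma push_nonneg {T : α → β} {a : α → ℝ} (ha : ∀ t, 0 ≤ a t) (s : β) : 0 ≤ push T a s := by
  classical
  exact Finset.sum_nonneg fun t _ => by split_ifs <;> simp [ha]

lemma sum_push_mul [Fintype β] (T : α → β) (a : α → ℝ) (F : β → ℝ) :
    ∑ s, push T a s * F s = ∑ t, a t * F (T t) := by
  classical
  simp only [push, Finset.sum_mul, ite_mul, zero_mul]
  rw [Finset.sum_comm]
  simp

lemma sum_push [Fintype β] (T : α → β) (a : α → ℝ) : ∑ s, push T a s = ∑ t, a t := by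
  simpa using sum_push_mul T a (fun _ => 1)

lemma push_push [Fintype β] (S : β → γ) (T : α → β) (a : α → ℝ) :
    push S (push T a) = push (S ∘ T) a := by
  classical
  funext s
  have := sum_push_mul T a (fun t => if S t = s then 1 else 0)
  simpa [push] using this

lemma push_le_push {T : α → β} {a b : α → ℝ} (h : ∀ t, a t ≤ b t) (s : β) :
    push T a s ≤ push T b s := by
  classical
  exact Finset.sum_le_sum fun t _ => by split_ifs <;> simp [h]

lemma push_sum {ι : Type*} (F : Finset ι) (T : α → β) (a : ι → α → ℝ) (s : β) :
    push T (fun t => ∑ m ∈ F, a m t) s = ∑ m ∈ F, push T (a m) s := by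
  classical
  simp only [push]
  rw [Finset.sum_comm]
  exact Finset.sum_congr rfl fun t _ => by split_ifs <;> simp

/-- The likelihood ratio of the push-forwards. -/
def pushRatio (π : α → β) (a b : α → ℝ) (s : β) : ℝ := push π a s / push π b s

/-- Domination `a ≤ b` makes the convention `0 / 0 = 0` harmless: where the push-forward of `b`
vanishes, so does that of `a`. -/
lemma sum_mul_pushRatio [Fintype β] {a b : α → ℝ} (ha : ∀ t, 0 ≤ a t) (hab : ∀ t, a t ≤ b t) (π : α → β) :
    ∑ t, b t * pushRatio π a b (π t) = ∑ t, a t := by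
  rw [← sum_push_mul π b, ← sum_push π a]
  refine Finset.sum_congr rfl fun s _ => ?_
  unfold pushRatio
  by_cases h : push π b s = 0
  · have h1 := push_nonneg (T := π) ha s
    have h2 := push_le_push (T := π) hab s
    rw [h] at h2 ⊢
    linarith
  · field_simp

lemma relEntropy_push [Fintype β] {a b : α → ℝ} (π : α → β) :
    relEntropy (push π a) (push π b) = ∑ t, a t * Real.log (pushRatio π a b (π t)) :=
  sum_push_mul π a (fun s => Real.log (push π a s / push π b s))

/-- A strengthened data processing inequality, with the squared Hellinger distance to the
projection as a remainder. -/
lemma sum_sq_sqrt_sub_le_relEntropy_sub [Fintype β] {a b : α → ℝ} (ha : ∀ t, 0 ≤ a t)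
    (hab : ∀ t, a t ≤ b t) (π : α → β) :
    ∑ t, (√(a t) - √(b t * pushRatio π a b (π t))) ^ 2
      ≤ relEntropy a b - relEntropy (push π a) (push π b) := by
  have hb : ∀ t, 0 ≤ b t := fun t => (ha t).trans (hab t)
  have hk : ∀ s, 0 ≤ pushRatio π a b s := fun s => div_nonneg (push_nonneg ha s) (push_nonneg hb s)
  -- The mass functions `a` and `b * pushRatio` have equal total mass, so the squared Hellinger
  -- distance is linear in the affinity `∑ √a √(b κ)`.
  have h1 : ∑ t, (√(a t) - √(b t * pushRatio π a b (π t))) ^ 2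
      = ∑ t, (2 * a t - 2 * (√(a t) * √(b t * pushRatio π a b (π t)))) := by
    have h2 := sum_mul_pushRatio ha hab π
    have h3 : ∀ t, (√(a t) - √(b t * pushRatio π a b (π t))) ^ 2
        = (2 * a t - 2 * (√(a t) * √(b t * pushRatio π a b (π t))))
          + (b t * pushRatio π a b (π t) - a t) := fun t => by
      have e1 := Real.sq_sqrt (ha t)
      have e2 := Real.sq_sqrt (mul_nonneg (hb t) (hk (π t)))
      nlinarith
    simp_rw [h3]
    rw [Finset.sum_add_distrib, Finset.sum_sub_distrib (f := fun t => b t * _), h2]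
    simp
  rw [h1, relEntropy_push, relEntropy, ← Finset.sum_sub_distrib]
  refine Finset.sum_le_sum fun t _ => ?_
  rcases (ha t).eq_or_lt with h0 | hpos
  · simp [← h0]
  have hbpos : 0 < b t := hpos.trans_le (hab t)
  have hkpos : 0 < pushRatio π a b (π t) := by
    classical
    have h : a t ≤ push π a (π t) := by
      have := Finset.single_le_sum (s := Finset.univ) (f := fun u => if π u = π t then a u else 0)
        (fun u _ => by split_ifs <;> simp [ha]) (Finset.mem_univ t)
      simpa [push] using this
    exact div_pos (hpos.trans_le h) ((hpos.trans_le h).trans_le (push_le_push hab _))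
  set k := pushRatio π a b (π t)
  have hbk : 0 < b t * k := mul_pos hbpos hkpos
  have e1 := Real.sq_sqrt (ha t)
  have e2 := Real.sq_sqrt hbk.le
  have sa : 0 < √(a t) := Real.sqrt_pos.2 hpos
  have sb : 0 < √(b t * k) := Real.sqrt_pos.2 hbk
  -- Applying `log u ≤ u - 1` to the square root of the likelihood ratio, not to the ratio itself,
  -- is what leaves the affinity, and hence a Hellinger remainder.
  have hlog : Real.log (a t / b t) - Real.log k = -(2 * Real.log (√(b t * k) / √(a t))) := by
    rw [Real.log_div sb.ne' sa.ne', Real.log_sqrt hbk.le, Real.log_sqrt hpos.le,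
      Real.log_div hpos.ne' hbpos.ne', Real.log_mul hbpos.ne' hkpos.ne']
    ring
  have hle := Real.log_le_sub_one_of_pos (div_pos sb sa)
  have h4 : a t * (√(b t * k) / √(a t)) = √(a t) * √(b t * k) := by
    rw [← mul_div_assoc, div_eq_iff sa.ne']
    nlinarith
  have h5 := mul_le_mul_of_nonneg_left hle hpos.le
  have h6 : a t * (Real.log (a t / b t) - Real.log k)
      = -(2 * (a t * Real.log (√(b t * k) / √(a t)))) := by
    rw [hlog]
    ring
  nlinarith

lemma relEntropy_push_le [Fintype β] {a b : α → ℝ} (ha : ∀ t, 0 ≤ a t) (hab : ∀ t, a t ≤ b t) (π : α → β) :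
    relEntropy (push π a) (push π b) ≤ relEntropy a b := by
  have h := sum_sq_sqrt_sub_le_relEntropy_sub ha hab π
  have h2 : 0 ≤ ∑ t, (√(a t) - √(b t * pushRatio π a b (π t))) ^ 2 :=
    Finset.sum_nonneg fun _ _ => sq_nonneg _
  linarith

end Push

/-! ### Conditional mutual information as a series of relative entropy differences -/

section CondMutualInfo

variable {U V W : Type*} [Fintype U] [Fintype W]

lemma condEntropy_term (f : U → ℝ) (hf : ∀ u, 0 ≤ f u) :
    (∑ u, f u) * ∑ u, Real.negMulLog (f u / ∑ u', f u')
      = ∑ u, -(f u * Real.log (f u / ∑ u', f u')) := by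
  rw [Finset.mul_sum]
  refine Finset.sum_congr rfl fun u _ => ?_
  by_cases h : ∑ u', f u' = 0
  · have := (Finset.sum_eq_zero_iff_of_nonneg fun u _ => hf u).1 h u (Finset.mem_univ u)
    simp [this]
  · unfold Real.negMulLog
    field_simp

/-- The conditional mutual information is a sum over the values of the first variable. -/
lemma hasSum_condMutualInfo (q : V → U → W → ℝ) (hq : ∀ v u w, 0 ≤ q v u w)
    (hs : ∀ u w, Summable fun v => q v u w) :
    HasSum (fun v => relEntropy (fun t : U × W => q v t.1 t.2) (fun t => ∑' v, q v t.1 t.2)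
      - relEntropy (fun w => ∑ u, q v u w) (fun w => ∑' v, ∑ u, q v u w)) (condMutualInfo q) := by
  set b : U → W → ℝ := fun u w => ∑' v, q v u w with hb
  have hb0 : ∀ u w, 0 ≤ b u w := fun u w => tsum_nonneg fun v => hq v u w
  have hle : ∀ v u w, q v u w ≤ b u w := fun v u w =>
    (hs u w).le_tsum v (fun _ _ => hq _ _ _)
  have hbw : ∀ w, ∑' v, ∑ u, q v u w = ∑ u, b u w := fun w =>
    Summable.tsum_finsetSum fun u _ => hs u w
  -- the unconditioned term
  have h1 : HasSum (fun v => ∑ w, ∑ u, -(q v u w * Real.log (b u w / ∑ u', b u' w)))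
      (condEntropy b) := by
    unfold condEntropy
    rw [tsum_fintype]
    refine hasSum_sum fun w _ => ?_
    rw [condEntropy_term (fun u => b u w) (fun u => hb0 u w)]
    exact hasSum_sum fun u _ => (((hs u w).hasSum).mul_right _).neg
  -- the conditioned term
  have hterm : ∀ v w, (∑ u, q v u w) * ∑ u, Real.negMulLog (q v u w / ∑ u', q v u' w)
      = ∑ u, -(q v u w * Real.log (q v u w / ∑ u', q v u' w)) := fun v w =>
    condEntropy_term (fun u => q v u w) (fun u => hq v u w)
  have hdiv : ∀ v u w, 0 ≤ q v u w / ∑ u', q v u' w ∧ q v u w / ∑ u', q v u' w ≤ 1 := fun v u w =>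
    ⟨div_nonneg (hq _ _ _) (Finset.sum_nonneg fun _ _ => hq _ _ _),
      div_le_one_of_le₀ (Finset.single_le_sum (f := fun u => q v u w) (fun _ _ => hq _ _ _)
        (Finset.mem_univ u)) (Finset.sum_nonneg fun _ _ => hq _ _ _)⟩
  have hnn : ∀ v w, 0 ≤ (∑ u, q v u w) * ∑ u, Real.negMulLog (q v u w / ∑ u', q v u' w) :=
    fun v w => mul_nonneg (Finset.sum_nonneg fun _ _ => hq _ _ _)
      (Finset.sum_nonneg fun u _ => Real.negMulLog_nonneg (hdiv v u w).1 (hdiv v u w).2)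
  -- Since `negMulLog ≤ 1` on `[0, 1]`, each entropy is at most `card U`, and the masses are
  -- summable.
  have hsw : ∀ w, Summable fun v =>
      (∑ u, q v u w) * ∑ u, Real.negMulLog (q v u w / ∑ u', q v u' w) := fun w => by
    have hS : Summable fun v => (∑ u, q v u w) * (Fintype.card U : ℝ) :=
      (summable_sum fun u _ => hs u w).mul_right _
    refine Summable.of_nonneg_of_le (fun v => hnn v w) (fun v => ?_) hS
    refine mul_le_mul_of_nonneg_left ?_ (Finset.sum_nonneg fun _ _ => hq _ _ _)
    refine (Finset.sum_le_card_nsmul _ _ 1 fun u _ => ?_).trans (by simp)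
    have := Real.negMulLog_le_one_sub_self (hdiv v u w).1
    linarith [(hdiv v u w).1]
  have hsp : Summable fun vw : V × W => (∑ u, q vw.1 u vw.2)
      * ∑ u, Real.negMulLog (q vw.1 u vw.2 / ∑ u', q vw.1 u' vw.2) := by
    rw [summable_prod_of_nonneg fun vw => hnn vw.1 vw.2]
    refine ⟨fun v => (hasSum_fintype _).summable, ?_⟩
    simp_rw [tsum_fintype]
    exact summable_sum fun w _ => hsw w
  have h2 : HasSum (fun v => ∑ w, ∑ u, -(q v u w * Real.log (q v u w / ∑ u', q v u' w)))
      (condEntropy (fun u (vw : V × W) => q vw.1 u vw.2)) := by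
    unfold condEntropy
    rw [hsp.tsum_prod]
    simp_rw [tsum_fintype]
    have : Summable fun v => ∑ w, (∑ u, q v u w)
      * ∑ u, Real.negMulLog (q v u w / ∑ u', q v u' w) := summable_sum fun w _ => hsw w
    simpa only [hterm] using this.hasSum
  have h3 := h1.sub h2
  refine h3.congr_fun fun v => ?_
  simp only [relEntropy, Fintype.sum_prod_type_right, Finset.sum_mul, hbw]
  rw [← Finset.sum_sub_distrib, ← Finset.sum_sub_distrib]
  refine Finset.sum_congr rfl fun w _ => ?_
  rw [← Finset.sum_sub_distrib, ← Finset.sum_sub_distrib]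
  refine Finset.sum_congr rfl fun u _ => ?_
  rcases (hq v u w).eq_or_lt with h0 | hpos
  · simp [← h0]
  have p1 : 0 < b u w := hpos.trans_le (hle v u w)
  have p2 : 0 < ∑ u', q v u' w := hpos.trans_le
    (Finset.single_le_sum (f := fun u => q v u w) (fun _ _ => hq _ _ _) (Finset.mem_univ u))
  have p3 : 0 < ∑ u', b u' w := p1.trans_le
    (Finset.single_le_sum (f := fun u => b u w) (fun _ _ => hb0 _ _) (Finset.mem_univ u))
  change q v u w * Real.log (q v u w / b u w) - _ = _
  rw [Real.log_div hpos.ne' p1.ne', Real.log_div p2.ne' p3.ne', Real.log_div p1.ne' p3.ne',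
    Real.log_div hpos.ne' p2.ne']
  ring

lemma push_fst {f : U × W → ℝ} : push Prod.fst f = fun u => ∑ w, f (u, w) := by
  classical
  funext u
  simp only [push, Fintype.sum_prod_type]
  rw [Finset.sum_eq_single u] <;> simp +contextual

lemma push_snd {f : U × W → ℝ} : push Prod.snd f = fun w => ∑ u, f (u, w) := by
  classical
  funext w
  simp [push, Fintype.sum_prod_type]

/-- This is data processing for the projection to `W`. Termwise nonnegativity allows restriction to
finitely many transcripts. -/
lemma relEntropy_sub_nonneg (q : V → U → W → ℝ) (hq : ∀ v u w, 0 ≤ q v u w)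
    (hs : ∀ u w, Summable fun v => q v u w) (v : V) :
    0 ≤ relEntropy (fun t : U × W => q v t.1 t.2) (fun t => ∑' v, q v t.1 t.2)
      - relEntropy (fun w => ∑ u, q v u w) (fun w => ∑' v, ∑ u, q v u w) := by
  have h := relEntropy_push_le (a := fun t : U × W => q v t.1 t.2)
    (b := fun t => ∑' v, q v t.1 t.2) (fun t => hq _ _ _)
    (fun t => (hs t.1 t.2).le_tsum v fun _ _ => hq _ _ _) Prod.snd
  simp only [push_snd] at h
  simp_rw [Summable.tsum_finsetSum fun u _ => hs u _]
  linarith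

/-- A Markov chain `V - W - U` has vanishing conditional mutual information `I(V ; U | W)`. -/
lemma condMutualInfo_eq_zero (q : V → U → W → ℝ) (hq : ∀ v u w, 0 ≤ q v u w)
    (hs : ∀ u w, Summable fun v => q v u w)
    (hm : MarkovChain fun (v : V) (w : W) (u : U) => q v u w) : condMutualInfo q = 0 := by
  have hbw : ∀ w, ∑' v, ∑ u, q v u w = ∑ u, ∑' v, q v u w := fun w =>
    Summable.tsum_finsetSum fun u _ => hs u w
  refine (hasSum_condMutualInfo q hq hs).unique ?_
  convert hasSum_zero using 2 with v
  simp only [relEntropy, Fintype.sum_prod_type_right, Finset.sum_mul]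
  rw [← Finset.sum_sub_distrib]
  refine Finset.sum_eq_zero fun w _ => ?_
  rw [← Finset.sum_sub_distrib]
  refine Finset.sum_eq_zero fun u _ => ?_
  rcases (hq v u w).eq_or_lt with h0 | hpos
  · simp [← h0]
  have p1 : 0 < ∑' v, q v u w := hpos.trans_le ((hs u w).le_tsum v fun _ _ => hq _ _ _)
  have p2 : 0 < ∑ u', q v u' w := hpos.trans_le
    (Finset.single_le_sum (f := fun u => q v u w) (fun _ _ => hq _ _ _) (Finset.mem_univ u))
  have p3 : 0 < ∑' v, ∑ u', q v u' w := p2.trans_le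
    ((summable_sum fun u _ => hs u w).le_tsum v fun _ _ => Finset.sum_nonneg fun _ _ => hq _ _ _)
  have h := hm v w u
  simp only [tsum_fintype] at h
  -- The Markov identity says exactly that the two likelihood ratios agree, so the logarithms
  -- cancel.
  have : q v u w / ∑' v, q v u w = (∑ u', q v u' w) / ∑' v, ∑ u', q v u' w := by
    rw [div_eq_div_iff p1.ne' p3.ne', h]
  rw [this, sub_self]

end CondMutualInfo

/-! ### Transcripts and the rectangle property of protocols -/

/-- The message that follows the transcript `h` when the next-message functions are `f`, `g`. -/
def nextMessage (turn : Transcript → Option Party) (f g : Transcript → Message) (h : Transcript) :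
    Option Message :=
  match turn h with
  | none => none
  | some Party.alice => some (f h)
  | some Party.bob => some (g h)

lemma transcriptAfter_succ (turn : Transcript → Option Party) (f g : Transcript → Message) (k : ℕ) :
    transcriptAfter turn f g (k + 1) = transcriptAfter turn f g k
      ++ (nextMessage turn f g (transcriptAfter turn f g k)).toList := by
  simp only [transcriptAfter, nextMessage]
  split <;> simp_all

/-- A transcript is reached iff each of its messages is the one that the users send. -/
lemma exists_transcriptAfter_eq_iff (turn : Transcript → Option Party)
    (f g : Transcript → Message) (m : Transcript) :
    (∃ k, transcriptAfter turn f g k = m) ↔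
      ∀ i : Fin m.length, nextMessage turn f g (m.take i) = some m[i] := by
  constructor
  · rintro ⟨k, rfl⟩
    induction k with
    | zero => intro i; exact absurd i.2 (by simp [transcriptAfter])
    | succ k ih =>
      have h := transcriptAfter_succ turn f g k
      generalize transcriptAfter turn f g (k + 1) = m' at h ⊢
      generalize transcriptAfter turn f g k = m at h ih
      cases hn : nextMessage turn f g m with
      | none =>
        rw [hn] at h
        simp only [Option.toList_none, List.append_nil] at h
        subst h
        exact ih
      | some u =>
        rw [hn] at h
        simp only [Option.toList_some] at h
        subst h
        rintro ⟨i, hi⟩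
        simp only [List.length_append, List.length_singleton] at hi
        rcases (Nat.lt_succ_iff_lt_or_eq.1 hi) with h1 | rfl
        · have := ih ⟨i, h1⟩
          simp only [Fin.getElem_fin] at this ⊢
          rw [List.take_append_of_le_length h1.le, List.getElem_append_left h1, this]
        · simp [hn]
  · intro h
    have key : ∀ i ≤ m.length, transcriptAfter turn f g i = m.take i := by
      intro i
      induction i with
      | zero => intro _; simp [transcriptAfter]
      | succ i ih =>
        intro hi
        rw [transcriptAfter_succ, ih (by omega), h ⟨i, by omega⟩]
        simp
    exact ⟨m.length, by simpa using key m.length le_rfl⟩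

namespace Protocol

variable {A B C : Type*}

/-- The randomness with which Alice, on input `a`, sends her part of `m`. -/
def setA (prot : Protocol A B C) (a : A) (m : Transcript) : Set prot.ΩA :=
  {r | ∀ i : Fin m.length, prot.turn (m.take i) = some Party.alice →
    prot.msgA a r (m.take i) = m[i]}

/-- The randomness with which Bob, on input `b`, sends his part of `m`. -/
def setB (prot : Protocol A B C) (b : B) (m : Transcript) : Set prot.ΩB :=
  {r | ∀ i : Fin m.length, prot.turn (m.take i) = some Party.bob →
    prot.msgB b r (m.take i) = m[i]}

/-- `m` is a complete transcript: the communication is over after `m` but not before. -/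
def Complete (prot : Protocol A B C) (m : Transcript) : Prop :=
  prot.turn m = none ∧ ∀ i : Fin m.length, prot.turn (m.take i) ≠ none

lemma measurableSet_setA (prot : Protocol A B C) (a : A) (m : Transcript) :
    MeasurableSet (prot.setA a m) := by
  unfold setA
  rw [Set.ofPred_forall]
  refine MeasurableSet.iInter fun i => ?_
  by_cases h : prot.turn (m.take i) = some Party.alice
  · simpa [h] using prot.msgA_measurable a (m.take i) m[i]
  · simp [h]

lemma measurableSet_setB (prot : Protocol A B C) (b : B) (m : Transcript) :
    MeasurableSet (prot.setB b m) := by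
  unfold setB
  rw [Set.ofPred_forall]
  refine MeasurableSet.iInter fun i => ?_
  by_cases h : prot.turn (m.take i) = some Party.bob
  · simpa [h] using prot.msgB_measurable b (m.take i) m[i]
  · simp [h]

/-- The event that the complete transcript is `m` and the output is `c`. -/
def event (prot : Protocol A B C) (a : A) (b : B) (m : Transcript) (c : C) :
    Set (prot.ΩA × prot.ΩB) :=
  {r | prot.turn m = none ∧
      (∃ k, transcriptAfter prot.turn (prot.msgA a r.1) (prot.msgB b r.2) k = m) ∧
      prot.out b r.2 m = c}

lemma exists_transcriptAfter_iff (prot : Protocol A B C) (a : A) (b : B) (m : Transcript)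
    (r : prot.ΩA × prot.ΩB) :
    (∃ k, transcriptAfter prot.turn (prot.msgA a r.1) (prot.msgB b r.2) k = m) ↔
      (∀ i : Fin m.length, prot.turn (m.take i) ≠ none) ∧ r.1 ∈ prot.setA a m ∧
        r.2 ∈ prot.setB b m := by
  rw [exists_transcriptAfter_eq_iff]
  simp only [setA, setB, Set.mem_ofPred_eq, ← forall_and]
  refine forall_congr' fun i => ?_
  unfold nextMessage
  rcases h : prot.turn (m.take i) with _ | _ | _ <;> simp

/-- For fixed `m`, each round constrains only the randomness of its speaker, and the output only
Bob's, so the event is a rectangle. Independence of the two sources then factors the law. -/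
lemma event_eq (prot : Protocol A B C) (a : A) (b : B) (m : Transcript) (c : C)
    (hm : prot.Complete m) :
    prot.event a b m c = prot.setA a m ×ˢ (prot.setB b m ∩ {r | prot.out b r m = c}) := by
  ext r
  simp only [event, Set.mem_ofPred_eq, exists_transcriptAfter_iff, Set.mem_prod, Set.mem_inter_iff]
  have := hm.1
  have := hm.2
  tauto

lemma event_eq_empty (prot : Protocol A B C) (a : A) (b : B) (m : Transcript) (c : C)
    (hm : ¬ prot.Complete m) : prot.event a b m c = ∅ := by
  ext r
  simp only [event, Set.mem_ofPred_eq, exists_transcriptAfter_iff, Set.mem_empty_iff_false,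
    iff_false]
  unfold Complete at hm
  tauto

lemma measurableSet_event (prot : Protocol A B C) (a : A) (b : B) (m : Transcript) (c : C) :
    MeasurableSet (prot.event a b m c) := by
  by_cases hm : prot.Complete m
  · rw [event_eq _ _ _ _ _ hm]
    exact (prot.measurableSet_setA a m).prod
      ((prot.measurableSet_setB b m).inter (prot.out_measurable b m c))
  · rw [event_eq_empty _ _ _ _ _ hm]
    exact MeasurableSet.empty

/-- The joint law of transcript and output factors into a contribution of Alice and one of Bob. -/
lemma exists_law_eq_mul (prot : Protocol A B C) :
    ∃ (α : A → Transcript → ℝ) (β : B → Transcript → C → ℝ), (∀ a m, 0 ≤ α a m) ∧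
      (∀ b m c, 0 ≤ β b m c) ∧ ∀ a b m c, prot.law a b m c = α a m * β b m c := by
  classical
  refine ⟨fun a m => prot.μA.real (prot.setA a m),
    fun b m c => if prot.Complete m then
      prot.μB.real (prot.setB b m ∩ {r | prot.out b r m = c}) else 0,
    fun a m => measureReal_nonneg, fun b m c => ?_, fun a b m c => ?_⟩
  · dsimp only
    split_ifs <;> simp
  · change (prot.μA.prod prot.μB).real (prot.event a b m c) = _
    dsimp only
    split_ifs with hm
    · rw [event_eq _ _ _ _ _ hm, measureReal_prod_prod]
    · rw [event_eq_empty _ _ _ _ _ hm]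
      simp

lemma law_nonneg (prot : Protocol A B C) (a : A) (b : B) (m : Transcript) (c : C) :
    0 ≤ prot.law a b m c := measureReal_nonneg

lemma transcriptAfter_add (turn : Transcript → Option Party) (f g : Transcript → Message)
    {k : ℕ} (h : turn (transcriptAfter turn f g k) = none) (l : ℕ) :
    transcriptAfter turn f g (k + l) = transcriptAfter turn f g k := by
  induction l with
  | zero => rfl
  | succ l ih => rw [← add_assoc, transcriptAfter_succ, ih]; simp [nextMessage, h]

/-- A run stays constant once the communication is over, so it has only one complete transcript. -/
lemma pairwise_disjoint_event (prot : Protocol A B C) (a : A) (b : B) :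
    Pairwise (Function.onFun Disjoint fun mc : Transcript × C => prot.event a b mc.1 mc.2) := by
  rintro ⟨m, c⟩ ⟨m', c'⟩ hne
  refine Set.disjoint_left.2 fun r hr hr' => hne ?_
  obtain ⟨h1, ⟨k, hk⟩, h3⟩ := hr
  obtain ⟨h1', ⟨k', hk'⟩, h3'⟩ := hr'
  dsimp only at *
  have hmm : m = m' := by
    rcases le_total k k' with h | h <;> obtain ⟨l, rfl⟩ := Nat.exists_eq_add_of_le h
    · rw [← hk, ← hk']
      exact (transcriptAfter_add _ _ _ (by rw [hk, h1]) l).symm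
    · rw [← hk, ← hk']
      exact transcriptAfter_add _ _ _ (by rw [hk', h1']) l
  subst hmm
  rw [← h3, ← h3']

/-- The events are disjoint, and almost sure termination says that they cover everything up to a
null set. -/
lemma hasSum_law [Finite C] (prot : Protocol A B C) (a : A) (b : B) :
    HasSum (fun mc : Transcript × C => prot.law a b mc.1 mc.2) 1 := by
  have h1 : (prot.μA.prod prot.μB) (⋃ mc : Transcript × C, prot.event a b mc.1 mc.2) = 1 := by
    rw [← prob_compl_eq_zero_iff (MeasurableSet.iUnion fun mc : Transcript × C =>
      prot.measurableSet_event a b mc.1 mc.2)]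
    refine measure_mono_null (fun r hr => ?_) (prot.halts a b)
    rintro ⟨k, hk⟩
    exact hr (Set.mem_iUnion.2 ⟨(_, prot.out b r.2 _), hk, ⟨k, rfl⟩, rfl⟩)
  rw [measure_iUnion (prot.pairwise_disjoint_event a b)
    fun mc => prot.measurableSet_event a b mc.1 mc.2] at h1
  have := ENNReal.hasSum_toReal (f := fun mc : Transcript × C =>
    (prot.μA.prod prot.μB) (prot.event a b mc.1 mc.2)) (by simp [h1])
  rw [← ENNReal.tsum_toReal_eq (fun _ => measure_ne_top _ _), h1] at this
  exact this

lemma summable_law [Finite C] (prot : Protocol A B C) (a : A) (b : B) (c : C) :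
    Summable fun m => prot.law a b m c :=
  (prot.hasSum_law a b).summable.comp_injective
    (i := fun m => (m, c)) fun _ _ h => (Prod.ext_iff.1 h).1

lemma sum_outLaw [Fintype C] (prot : Protocol A B C) (a : A) (b : B) :
    ∑ c, prot.outLaw a b c = 1 := by
  unfold outLaw
  rw [← Summable.tsum_finsetSum fun c _ => prot.summable_law a b c, ← (prot.hasSum_law a b).tsum_eq,
    (prot.hasSum_law a b).summable.tsum_prod]
  simp

end Protocol

/-! ### Almost secure auxiliary variables force column monochromaticity -/

namespace Problem

universe w

variable {X Y Z : Type*} [Fintype X] [Fintype Y] [Fintype Z]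

/-- An auxiliary variable `u`, with joint law `p(x, y) A(u, x) B(u, y, z)`, that is up to `δ`
independent of `(y, z)` given `x` and of `x` given `(y, z)`. -/
structure AlmostSecure (P : Problem X Y Z) {ι : Type*} (δ : ℝ) (F : Finset ι) (A : ι → X → ℝ)
    (B : ι → Y → Z → ℝ) (g : X → ι → ℝ) (h : Y → Z → ι → ℝ) : Prop where
  nonneg_B : ∀ u y z, 0 ≤ B u y z
  close_x : ∀ x y z,
    ∑ u ∈ F, |P.pXY x y * (A u x * B u y z) - P.pXY x y * P.pZ x y z * g x u| ≤ δ
  close_yz : ∀ x y z,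
    ∑ u ∈ F, |P.pXY x y * (A u x * B u y z) - P.pXY x y * P.pZ x y z * h y z u| ≤ δ
  mass : ∀ x y, |∑ u ∈ F, ∑ z, P.pXY x y * (A u x * B u y z) - P.pXY x y| ≤ δ

/-- A triple of positive mass forces `g x` and `h y z` together, and the witness `(y, z)` of
confusability serves both inputs. The constant depends only on the problem and the inputs, so it
survives `δ → 0`. -/
lemma AlmostSecure.le_of_confusable (P : Problem X Y Z) {x x' : X} (hx : P.Confusable x x') :
    ∃ K : ℝ, ∀ {ι : Type w} (δ : ℝ) (F : Finset ι) (A : ι → X → ℝ)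
      (B : ι → Y → Z → ℝ) (g : X → ι → ℝ) (h : Y → Z → ι → ℝ), P.AlmostSecure δ F A B g h →
      ∑ u ∈ F, |g x u - g x' u| ≤ K * δ := by
  obtain ⟨-, y, z, h1, h2, h3, h4⟩ := hx
  have key : ∀ x, 0 < P.pXY x y * P.pZ x y z → ∀ {ι : Type w} (δ : ℝ) (F : Finset ι)
      (A : ι → X → ℝ) (B : ι → Y → Z → ℝ) (g : X → ι → ℝ) (h : Y → Z → ι → ℝ),
      P.AlmostSecure δ F A B g h →
      ∑ u ∈ F, |g x u - h y z u| ≤ 2 / (P.pXY x y * P.pZ x y z) * δ := by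
    intro x hr ι δ F A B g h H
    rw [div_mul_eq_mul_div, le_div_iff₀ hr, Finset.sum_mul]
    calc _ ≤ ∑ u ∈ F, (|P.pXY x y * (A u x * B u y z) - P.pXY x y * P.pZ x y z * g x u|
          + |P.pXY x y * (A u x * B u y z) - P.pXY x y * P.pZ x y z * h y z u|) := by
          refine Finset.sum_le_sum fun u _ => ?_
          rw [← abs_of_pos hr, ← abs_mul, abs_of_pos hr]
          refine le_trans (le_of_eq ?_) ((abs_sub _ _).trans (le_of_eq (add_comm _ _)))
          congr 1
          ring
      _ ≤ δ + δ := by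
          rw [Finset.sum_add_distrib]
          exact add_le_add (H.close_x x y z) (H.close_yz x y z)
      _ = 2 * δ := by ring
  refine ⟨2 / (P.pXY x y * P.pZ x y z) + 2 / (P.pXY x' y * P.pZ x' y z),
    fun {ι} δ F A B g h H => ?_⟩
  have e1 := key x (mul_pos h1 h3) δ F A B g h H
  have e2 := key x' (mul_pos h2 h4) δ F A B g h H
  rw [add_mul]
  refine le_trans ?_ (add_le_add e1 e2)
  rw [← Finset.sum_add_distrib]
  refine Finset.sum_le_sum fun u _ => ?_
  rw [abs_sub_comm (g x' u)]
  exact abs_sub_le _ _ _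

lemma AlmostSecure.le_of_chain (P : Problem X Y Z) {x x' : X}
    (hx : Relation.ReflTransGen P.Confusable x x') :
    ∃ K : ℝ, ∀ {ι : Type w} (δ : ℝ) (F : Finset ι) (A : ι → X → ℝ)
      (B : ι → Y → Z → ℝ) (g : X → ι → ℝ) (h : Y → Z → ι → ℝ), P.AlmostSecure δ F A B g h →
      ∑ u ∈ F, |g x u - g x' u| ≤ K * δ := by
  induction hx with
  | refl => exact ⟨0, fun {ι} δ F A B g h _ => by simp⟩
  | tail _ hbc ih =>
    obtain ⟨K, hK⟩ := ih
    obtain ⟨L, hL⟩ := AlmostSecure.le_of_confusable P hbc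
    refine ⟨K + L, fun {ι} δ F A B g h H => ?_⟩
    rw [add_mul]
    refine le_trans ?_ (add_le_add (hK δ F A B g h H) (hL δ F A B g h H))
    rw [← Finset.sum_add_distrib]
    exact Finset.sum_le_sum fun u _ => abs_sub_le _ _ _

/-- If there are auxiliary variables that are secure up to every `δ > 0`, then the classes are
column monochromatic. -/
theorem columnMonochromatic_of_almostSecure (P : Problem X Y Z)
    (H : ∀ δ : ℝ, 0 < δ → ∃ (ι : Type w) (F : Finset ι) (A : ι → X → ℝ)
      (B : ι → Y → Z → ℝ) (g : X → ι → ℝ) (h : Y → Z → ι → ℝ), P.AlmostSecure δ F A B g h) :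
    ∀ C ∈ P.chainSetoid.classes, P.ColumnMonochromatic C Set.univ := by
  rintro C ⟨x₀, rfl⟩ y - x hx x' hx' - hp hp' z
  have hxx' : Relation.ReflTransGen P.Confusable x x' :=
    P.chainSetoid.trans hx (P.chainSetoid.symm hx')
  obtain ⟨K, hK⟩ := AlmostSecure.le_of_chain.{w} P hxx'
  set N : ℝ := (Fintype.card Z : ℝ) with hN
  have hNn : 0 ≤ N := Nat.cast_nonneg _
  -- After division by `p(x, y)`: the closeness for each `z`, its sum over `z`, and the consequence
  -- that `g x` is nearly a probability law on `F`.
  have hc : ∀ x, 0 < P.pXY x y → ∀ (δ : ℝ) (ι : Type w) (F : Finset ι) (A : ι → X → ℝ)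
      (B : ι → Y → Z → ℝ) (g : X → ι → ℝ) (h : Y → Z → ι → ℝ), P.AlmostSecure δ F A B g h →
      (∀ z, ∑ u ∈ F, |A u x * B u y z - P.pZ x y z * g x u| ≤ δ / P.pXY x y) ∧
      (∑ u ∈ F, |A u x * ∑ z, B u y z - g x u| ≤ N * (δ / P.pXY x y)) ∧
      |∑ u ∈ F, g x u - 1| ≤ (N + 1) * (δ / P.pXY x y) := by
    intro x hpx δ ι F A B g h hs
    have c1 : ∀ z, ∑ u ∈ F, |A u x * B u y z - P.pZ x y z * g x u| ≤ δ / P.pXY x y := by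
      intro z
      rw [le_div_iff₀ hpx, Finset.sum_mul]
      refine le_trans (Finset.sum_le_sum fun u _ => le_of_eq ?_) (hs.close_x x y z)
      rw [← abs_of_pos hpx, ← abs_mul, abs_of_pos hpx]
      congr 1
      ring
    have c2 : ∑ u ∈ F, |A u x * ∑ z, B u y z - g x u| ≤ N * (δ / P.pXY x y) := by
      calc _ ≤ ∑ u ∈ F, ∑ z, |A u x * B u y z - P.pZ x y z * g x u| := by
            refine Finset.sum_le_sum fun u _ => ?_
            refine le_trans (le_of_eq ?_) (Finset.abs_sum_le_sum_abs _ _)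
            rw [Finset.sum_sub_distrib, ← Finset.mul_sum, ← Finset.sum_mul, P.pZ_sum, one_mul]
        _ ≤ _ := by
            rw [Finset.sum_comm]
            refine (Finset.sum_le_card_nsmul _ _ _ fun z _ => c1 z).trans ?_
            simp [hN]
    refine ⟨c1, c2, ?_⟩
    have c3 : |∑ u ∈ F, A u x * ∑ z, B u y z - 1| ≤ δ / P.pXY x y := by
      rw [le_div_iff₀ hpx]
      refine le_trans (le_of_eq ?_) (hs.mass x y)
      rw [← abs_of_pos hpx, ← abs_mul, abs_of_pos hpx]
      simp_rw [← Finset.mul_sum]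
      congr 1
      ring
    have c4 : |∑ u ∈ F, g x u - ∑ u ∈ F, A u x * ∑ z, B u y z| ≤ N * (δ / P.pXY x y) := by
      rw [abs_sub_comm, ← Finset.sum_sub_distrib]
      exact (Finset.abs_sum_le_sum_abs _ _).trans c2
    calc _ ≤ _ := abs_sub_le _ (∑ u ∈ F, A u x * ∑ z, B u y z) _
      _ ≤ _ := add_le_add c4 c3
      _ = _ := by ring
  set L : ℝ := 1 / P.pXY x y with hL
  set L' : ℝ := 1 / P.pXY x' y with hL'
  -- The constant collects five errors (`s1` to `s5`) along the path `p(z|x,y)`, `p(z|x,y) ∑ g x`,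
  -- `∑ A(u,x) B`, `∑ A(u,x') B`, `p(z|x',y) ∑ g x'`, `p(z|x',y)`.
  have main : ∀ δ : ℝ, 0 < δ → |P.pZ x y z - P.pZ x' y z| ≤
      (P.pZ x y z * ((N + 1) * L) + L + (N * L + K + N * L') + L'
        + P.pZ x' y z * ((N + 1) * L')) * δ := by
    intro δ hδ
    obtain ⟨ι, F, A, B, g, h, hs⟩ := H δ hδ
    obtain ⟨a1, a2, a3⟩ := hc x hp δ ι F A B g h hs
    obtain ⟨b1, b2, b3⟩ := hc x' hp' δ ι F A B g h hs
    have hg := hK δ F A B g h hs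
    have eL : δ / P.pXY x y = L * δ := by rw [hL]; ring
    have eL' : δ / P.pXY x' y = L' * δ := by rw [hL']; ring
    rw [eL] at a1 a2 a3
    rw [eL'] at b1 b2 b3
    have m : ∑ u ∈ F, |A u x * B u y z - A u x' * B u y z| ≤ (N * L + K + N * L') * δ := by
      calc _ ≤ ∑ u ∈ F, (|A u x * ∑ z, B u y z - g x u| + |g x u - g x' u|
            + |A u x' * ∑ z, B u y z - g x' u|) := by
            refine Finset.sum_le_sum fun u _ => ?_
            -- The product form enters here: both terms carry the same nonnegative factor `B u y z`,
            -- which is at most its sum over `z`.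
            have h1 : |A u x * B u y z - A u x' * B u y z|
                ≤ |A u x * ∑ z, B u y z - A u x' * ∑ z, B u y z| := by
              rw [← sub_mul, ← sub_mul, abs_mul, abs_mul, abs_of_nonneg (hs.nonneg_B u y z),
                abs_of_nonneg (Finset.sum_nonneg fun z _ => hs.nonneg_B u y z)]
              exact mul_le_mul_of_nonneg_left (Finset.single_le_sum
                (f := fun z => B u y z) (fun z _ => hs.nonneg_B u y z) (Finset.mem_univ z))
                (abs_nonneg _)
            refine h1.trans ((abs_sub_le _ (g x u) _).trans ?_)
            rw [add_assoc]
            refine add_le_add le_rfl ((abs_sub_le _ (g x' u) _).trans ?_)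
            rw [abs_sub_comm (g x' u)]
        _ ≤ _ := by
            rw [Finset.sum_add_distrib, Finset.sum_add_distrib]
            linarith
    have s1 : |P.pZ x y z - P.pZ x y z * ∑ u ∈ F, g x u|
        ≤ P.pZ x y z * ((N + 1) * (L * δ)) := by
      rw [show P.pZ x y z - P.pZ x y z * ∑ u ∈ F, g x u
        = P.pZ x y z * (1 - ∑ u ∈ F, g x u) by ring, abs_mul, abs_of_nonneg (P.pZ_nonneg _ _ _),
        abs_sub_comm]
      exact mul_le_mul_of_nonneg_left a3 (P.pZ_nonneg _ _ _)
    have s5 : |P.pZ x' y z - P.pZ x' y z * ∑ u ∈ F, g x' u|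
        ≤ P.pZ x' y z * ((N + 1) * (L' * δ)) := by
      rw [show P.pZ x' y z - P.pZ x' y z * ∑ u ∈ F, g x' u
        = P.pZ x' y z * (1 - ∑ u ∈ F, g x' u) by ring, abs_mul, abs_of_nonneg (P.pZ_nonneg _ _ _),
        abs_sub_comm]
      exact mul_le_mul_of_nonneg_left b3 (P.pZ_nonneg _ _ _)
    have s2 : |∑ u ∈ F, A u x * B u y z - P.pZ x y z * ∑ u ∈ F, g x u| ≤ L * δ := by
      rw [Finset.mul_sum, ← Finset.sum_sub_distrib]
      exact (Finset.abs_sum_le_sum_abs _ _).trans (a1 z)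
    have s4 : |∑ u ∈ F, A u x' * B u y z - P.pZ x' y z * ∑ u ∈ F, g x' u| ≤ L' * δ := by
      rw [Finset.mul_sum, ← Finset.sum_sub_distrib]
      exact (Finset.abs_sum_le_sum_abs _ _).trans (b1 z)
    have s3 : |∑ u ∈ F, A u x * B u y z - ∑ u ∈ F, A u x' * B u y z|
        ≤ (N * L + K + N * L') * δ := by
      rw [← Finset.sum_sub_distrib]
      exact (Finset.abs_sum_le_sum_abs _ _).trans m
    rw [abs_le] at s1 s2 s3 s4 s5 ⊢
    constructor <;> nlinarith [s1.1, s2.1, s3.1, s4.1, s5.1, s1.2, s2.2, s3.2, s4.2, s5.2]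
  have h0 : |P.pZ x y z - P.pZ x' y z| ≤ 0 := by
    set c := P.pZ x y z * ((N + 1) * L) + L + (N * L + K + N * L') + L'
        + P.pZ x' y z * ((N + 1) * L')
    have ht : Tendsto (fun δ : ℝ => c * δ) (𝓝[>] 0) (𝓝 0) := by
      have : Tendsto (fun δ : ℝ => c * δ) (𝓝 0) (𝓝 (c * 0)) := (continuous_const_mul c).tendsto 0
      rw [mul_zero] at this
      exact this.mono_left nhdsWithin_le_nhds
    exact ge_of_tendsto ht (eventually_nhdsWithin_of_forall fun δ hδ => main δ hδ)
  exact sub_eq_zero.1 (abs_nonpos_iff.1 h0)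

/-- Perfect security implies that the classes are column monochromatic. -/
theorem columnMonochromatic_of_perfectlyComputable (P : Problem X Y Z)
    (hP : P.PerfectlyComputable) : ∀ C ∈ P.chainSetoid.classes, P.ColumnMonochromatic C Set.univ := by
  classical
  obtain ⟨prot, hout, hM1, hM2⟩ := hP
  obtain ⟨α, β, hα, hβ, hlaw⟩ := prot.exists_law_eq_mul
  have hj0 : ∀ x y m z, 0 ≤ prot.joint P x y m z := fun x y m z =>
    mul_nonneg (P.pXY_nonneg _ _) (prot.law_nonneg _ _ _ _)
  have hjs : ∀ x y z, Summable fun m => prot.joint P x y m z := fun x y z =>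
    (prot.summable_law x y z).mul_left _
  have hjt : ∀ x y z, ∑' m, prot.joint P x y m z = P.pXY x y * P.pZ x y z := fun x y z => by
    unfold Protocol.joint
    rw [tsum_mul_left]
    rcases (P.pXY_nonneg x y).eq_or_lt with h | h
    · simp [← h]
    · rw [← hout x y h z]; rfl
  have hE1 : ∀ x, ∑' m, ∑ yz : Y × Z, prot.joint P x yz.1 m yz.2
      = ∑ yz : Y × Z, P.pXY x yz.1 * P.pZ x yz.1 yz.2 := fun x => by
    have h := Summable.tsum_finsetSum (s := Finset.univ) (f := fun (yz : Y × Z) m =>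
      prot.joint P x yz.1 m yz.2) fun yz _ => hjs x yz.1 yz.2
    simpa only [hjt] using h
  have hE2 : ∀ y z, ∑' m, ∑ x, prot.joint P x y m z
      = ∑ x, P.pXY x y * P.pZ x y z := fun y z => by
    have h := Summable.tsum_finsetSum (s := Finset.univ) (f := fun x m =>
      prot.joint P x y m z) fun x _ => hjs x y z
    simpa only [hjt] using h
  refine P.columnMonochromatic_of_almostSecure fun δ hδ => ?_
  have hsum : HasSum (fun m => fun xy : X × Y => ∑ z, prot.joint P xy.1 xy.2 m z)
      (fun xy : X × Y => P.pXY xy.1 xy.2) := by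
    rw [Pi.hasSum]
    intro xy
    have := hasSum_sum (s := Finset.univ) fun z _ => (hjs xy.1 xy.2 z).hasSum
    simp_rw [hjt, ← Finset.mul_sum, P.pZ_sum, mul_one] at this
    exact this
  -- Convergence in the sup metric gives one finite set of transcripts that works for all input
  -- pairs at once.
  obtain ⟨F, hF⟩ := (Metric.tendsto_nhds.1 hsum δ hδ).exists
  rw [dist_pi_lt_iff hδ] at hF
  -- The conditional laws of the transcript given `x` and given `(y, z)`. Both closeness errors
  -- vanish; only the truncation to `F` costs anything.
  refine ⟨Transcript, F, fun m x => α x m, fun m y z => β y m z,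
    fun x m => (∑ yz : Y × Z, prot.joint P x yz.1 m yz.2)
      / ∑ yz : Y × Z, P.pXY x yz.1 * P.pZ x yz.1 yz.2,
    fun y z m => (∑ x, prot.joint P x y m z) / ∑ x, P.pXY x y * P.pZ x y z,
    fun m y z => hβ y m z, fun x y z => ?_, fun x y z => ?_, fun x y => ?_⟩
  · refine le_trans (le_of_eq (Finset.sum_eq_zero fun m _ => ?_)) hδ.le
    rw [abs_eq_zero, sub_eq_zero]
    have := hM1 m x (y, z)
    simp only [tsum_fintype] at this
    rw [hE1, hjt] at this
    rw [← hlaw]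
    change prot.joint P x y m z = _
    by_cases h0 : ∑ yz : Y × Z, P.pXY x yz.1 * P.pZ x yz.1 yz.2 = 0
    · have h1 := (Finset.sum_eq_zero_iff_of_nonneg fun yz _ =>
        mul_nonneg (P.pXY_nonneg _ _) (P.pZ_nonneg _ _ _)).1 h0 (y, z) (Finset.mem_univ _)
      dsimp only at h1
      have h2 := (hjs x y z).le_tsum m fun _ _ => hj0 _ _ _ _
      rw [hjt, h1] at h2
      rw [h1, zero_mul]
      exact le_antisymm h2 (hj0 _ _ _ _)
    · rw [mul_div_assoc', eq_div_iff h0, this]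
      ring
  · refine le_trans (le_of_eq (Finset.sum_eq_zero fun m _ => ?_)) hδ.le
    rw [abs_eq_zero, sub_eq_zero]
    have := hM2 m (y, z) x
    simp only [tsum_fintype] at this
    rw [hE2, hjt] at this
    rw [← hlaw]
    change prot.joint P x y m z = _
    by_cases h0 : ∑ x, P.pXY x y * P.pZ x y z = 0
    · have h1 := (Finset.sum_eq_zero_iff_of_nonneg fun x _ =>
        mul_nonneg (P.pXY_nonneg _ _) (P.pZ_nonneg _ _ _)).1 h0 x (Finset.mem_univ _)
      have h2 := (hjs x y z).le_tsum m fun _ _ => hj0 _ _ _ _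
      rw [hjt, h1] at h2
      rw [h1, zero_mul]
      exact le_antisymm h2 (hj0 _ _ _ _)
    · rw [mul_div_assoc', eq_div_iff h0, this]
      ring
  · have := hF (x, y)
    rw [Real.dist_eq, Finset.sum_apply] at this
    simp_rw [← hlaw]
    exact this.le

end Problem

/-! ### Decoupling one coordinate of a word -/

/-- Cauchy–Schwarz applied to `|p - q| = |√p - √q| (√p + √q)`; the second factor has square sum at
most `4`. Mass at most one suffices, which accommodates finite sets of transcripts. -/
lemma sum_abs_sub_le_of_hellinger {ι : Type*} (s : Finset ι) {p q : ι → ℝ} {D : ℝ}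
    (hp : ∀ t ∈ s, 0 ≤ p t) (hq : ∀ t ∈ s, 0 ≤ q t) (hp1 : ∑ t ∈ s, p t ≤ 1)
    (hq1 : ∑ t ∈ s, q t ≤ 1) (hD : ∑ t ∈ s, (√(p t) - √(q t)) ^ 2 ≤ D) :
    ∑ t ∈ s, |p t - q t| ≤ 2 * √D := by
  have hD0 : 0 ≤ D := (Finset.sum_nonneg fun _ _ => sq_nonneg _).trans hD
  have h1 : ∀ t ∈ s, |p t - q t| = |√(p t) - √(q t)| * (√(p t) + √(q t)) := fun t ht => by
    rw [← abs_of_nonneg (add_nonneg (Real.sqrt_nonneg (p t)) (Real.sqrt_nonneg (q t))), ← abs_mul]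
    congr 1
    have e1 := Real.mul_self_sqrt (hp t ht)
    have e2 := Real.mul_self_sqrt (hq t ht)
    linear_combination -e1 + e2
  rw [Finset.sum_congr rfl h1]
  have h2 := Finset.sum_mul_sq_le_sq_mul_sq s (fun t => |√(p t) - √(q t)|)
    (fun t => √(p t) + √(q t))
  have h3 : ∑ t ∈ s, (√(p t) + √(q t)) ^ 2 ≤ 4 := by
    calc _ ≤ ∑ t ∈ s, (2 * p t + 2 * q t) := by
          refine Finset.sum_le_sum fun t ht => ?_
          have e1 := Real.sq_sqrt (hp t ht)
          have e2 := Real.sq_sqrt (hq t ht)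
          nlinarith [sq_nonneg (√(p t) - √(q t))]
      _ ≤ 4 := by
          rw [Finset.sum_add_distrib, ← Finset.mul_sum, ← Finset.mul_sum]
          linarith
  simp only [sq_abs] at h2
  have h4 : (∑ t ∈ s, |√(p t) - √(q t)| * (√(p t) + √(q t))) ^ 2 ≤ (2 * √D) ^ 2 := by
    refine h2.trans ((mul_le_mul hD h3 (Finset.sum_nonneg fun _ _ => sq_nonneg _) hD0).trans ?_)
    rw [mul_pow, Real.sq_sqrt hD0]
    linarith
  exact le_of_sq_le_sq h4 (by positivity)

section View

variable {E E' : Type*} {n : ℕ}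

open scoped Classical in
/-- The coordinates in `S` of `f`, and the coarse version of the other coordinates. -/
def view (c : E → E') (S : Set (Fin n)) (f : Fin n → E) : Fin n → E ⊕ E' :=
  fun j => if j ∈ S then Sum.inl (f j) else Sum.inr (c (f j))

/-- Replaces the `i`-th coordinate by its coarse version. -/
def coarsen (c : E → E') (i : Fin n) (t : Fin n → E ⊕ E') : Fin n → E ⊕ E' :=
  Function.update t i (Sum.elim (Sum.inr ∘ c) Sum.inr (t i))

/-- Consecutive views are linked by a map, so data processing applies to each step of the chain
rule. -/
lemma coarsen_view_insert (c : E → E') {S : Set (Fin n)} {i : Fin n} (hi : i ∉ S)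
    (f : Fin n → E) : coarsen c i (view c (insert i S) f) = view c S f := by
  funext j
  rcases eq_or_ne j i with rfl | hj
  · simp [coarsen, view, hi]
  · by_cases hS : j ∈ S <;> simp [coarsen, view, hj, hS, Set.mem_insert_iff]

lemma view_update_congr (c : E → E') {S : Set (Fin n)} {i : Fin n} (hi : i ∉ S)
    (f : Fin n → E) {e e' : E} (h : c e = c e') :
    view c S (Function.update f i e) = view c S (Function.update f i e') := by
  funext j
  rcases eq_or_ne j i with rfl | hj
  · simp [view, hi, h]
  · simp [view, hj]

lemma prod_eq_mul_prod_ne (r : E → ℝ) (i : Fin n) (f : Fin n → E) :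
    ∏ j, r (f j) = r (f i) * ∏ j : {j // j ≠ i}, r (f j) := by
  rw [← Finset.mul_prod_erase Finset.univ _ (Finset.mem_univ i)]
  congr 1
  exact Finset.prod_subtype _ (by simp) _

variable [Fintype E] [Fintype E']

/-- Under a product law the `i`-th coordinate is independent of the others, so fixing it to `e`
amounts to overwriting it by `e`. -/
lemma sum_prod_mul_ite [DecidableEq E] {r : E → ℝ} (hr : ∑ e, r e = 1) (i : Fin n)
    (F : (Fin n → E) → ℝ) (e : E) :
    ∑ f : Fin n → E, (∏ j, r (f j)) * (if f i = e then F f else 0)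
      = r e * ∑ f : Fin n → E, (∏ j, r (f j)) * F (Function.update f i e) := by
  have hup : ∀ (e' : E) (g : {j // j ≠ i} → E),
      Function.update ((Equiv.funSplitAt i E).symm (e', g)) i e = (Equiv.funSplitAt i E).symm (e, g) := by
    intro e' g
    funext j
    rcases eq_or_ne j i with rfl | hj
    · simp [Equiv.funSplitAt, Equiv.piSplitAt]
    · simp [Equiv.funSplitAt, Equiv.piSplitAt, hj]
  have hi : ∀ (e' : E) (g : {j // j ≠ i} → E), (Equiv.funSplitAt i E).symm (e', g) i = e' := by
    intro e' g
    simp [Equiv.funSplitAt, Equiv.piSplitAt]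
  have hne : ∀ (e' : E) (g : {j // j ≠ i} → E) (j : {j // j ≠ i}),
      (Equiv.funSplitAt i E).symm (e', g) j = g j := by
    intro e' g j
    simp [Equiv.funSplitAt, Equiv.piSplitAt, j.2]
  simp_rw [prod_eq_mul_prod_ne r i]
  rw [← (Equiv.funSplitAt i E).symm.sum_comp, ← (Equiv.funSplitAt i E).symm.sum_comp (fun f => _ * F _)]
  simp_rw [Fintype.sum_prod_type, hup, hi, hne]
  rw [Finset.sum_eq_single e (by intro b _ hb; simp [hb]) (by simp)]
  simp only [if_true, mul_assoc, ← Finset.mul_sum, ← Finset.sum_mul, hr, one_mul]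

/-- The one-coordinate decoupling estimate. -/
theorem exists_coarse_approx {M V : Type*} [Fintype V] (F : Finset M)
    {a : M → (Fin n → E) → ℝ} {b : (Fin n → E) → ℝ} (ha : ∀ m f, 0 ≤ a m f)
    (hab : ∀ f, ∑ m ∈ F, a m f ≤ b f) (hb1 : ∑ f, b f ≤ 1) {r : E → ℝ} (hr : ∑ e, r e = 1)
    {ε D : ℝ} (hε : ∑ f, |b f - ∏ j, r (f j)| ≤ ε) (c : E → E') {S : Set (Fin n)} {i : Fin n}
    (hi : i ∉ S)
    (hD : ∑ m ∈ F, (relEntropy (push (view c (insert i S)) (a m)) (push (view c (insert i S)) b)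
      - relEntropy (push (view c S) (a m)) (push (view c S) b)) ≤ D)
    (ψ : (Fin n → E ⊕ E') → V) :
    ∃ G : E → M → V → ℝ, (∀ e e', c e = c e' → G e = G e') ∧
      ∑ m ∈ F, ∑ v, ∑ e, |push (fun f => (f i, ψ (view c S f))) (a m) (e, v) - r e * G e m v|
        ≤ 2 * √D + ε := by
  classical
  set T := view c (insert i S) with hT
  set π := coarsen c i with hπ
  have hb : ∀ f, 0 ≤ b f := fun f => (Finset.sum_nonneg fun m _ => ha m f).trans (hab f)
  have hab1 : ∀ m ∈ F, ∀ f, a m f ≤ b f := fun m hm f =>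
    (Finset.single_le_sum (f := fun m => a m f) (fun m _ => ha m f) hm).trans (hab f)
  have hπT : ∀ f, π (T f) = view c S f := coarsen_view_insert c hi
  have hcomp : π ∘ T = view c S := funext hπT
  -- The conditional law of `m` given the coarse view, which sees the `i`-th coordinate only through
  -- `c`.
  set κ : M → (Fin n → E ⊕ E') → ℝ := fun m s => pushRatio π (push T (a m)) (push T b) s with hκ
  have hκ0 : ∀ m s, 0 ≤ κ m s := fun m s =>
    div_nonneg (push_nonneg (push_nonneg (ha m)) s) (push_nonneg (push_nonneg hb) s)
  have hκ1 : ∀ s, ∑ m ∈ F, κ m s ≤ 1 := fun s => by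
    change ∑ m ∈ F, push π (push T (a m)) s / push π (push T b) s ≤ 1
    rw [← Finset.sum_div]
    refine div_le_one_of_le₀ ?_ (push_nonneg (push_nonneg hb) s)
    simp_rw [push_push]
    rw [← push_sum]
    exact push_le_push hab s
  -- the indicator of the pair to be considered
  set I : E → V → (Fin n → E ⊕ E') → ℝ :=
    fun e v t => if t i = Sum.inl e ∧ ψ (π t) = v then 1 else 0 with hI
  have hI0 : ∀ e v t, 0 ≤ I e v t := fun e v t => by simp only [hI]; split_ifs <;> simp
  have hI1 : ∀ t, ∑ v, ∑ e, I e v t ≤ 1 := fun t => by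
    rw [Finset.sum_eq_single (ψ (π t)) (by intro v _ hv; simp [hI, hv.symm]) (by simp)]
    rcases h : t i with e | e
    · rw [Finset.sum_eq_single e (by intro e' _ he'; simp [hI, h, he'.symm]) (by simp)]
      simp only [hI]; split_ifs <;> simp
    · simp [hI, h]
  have hIT : ∀ e v f, I e v (T f) = if (f i, ψ (view c S f)) = (e, v) then 1 else 0 := by
    intro e v f
    simp only [hI, hπT, Prod.mk.injEq]
    simp [hT, view]
  have hs : ∀ m e v, push (fun f => (f i, ψ (view c S f))) (a m) (e, v)
      = ∑ t, push T (a m) t * I e v t := fun m e v => by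
    rw [sum_push_mul]
    simp only [hIT, push]
    refine Finset.sum_congr rfl fun f _ => ?_
    split_ifs <;> simp
  -- first step: from the joint law to the decoupled law
  have step1 : ∑ m ∈ F, ∑ t, |push T (a m) t - push T b t * κ m (π t)| ≤ 2 * √D := by
    rw [← Finset.sum_product']
    have hP1 : ∑ x ∈ F ×ˢ (Finset.univ : Finset (Fin n → E ⊕ E')), push T (a x.1) x.2 ≤ 1 := by
      rw [Finset.sum_product]
      simp only [sum_push]
      rw [Finset.sum_comm]
      exact (Finset.sum_le_sum fun f _ => hab f).trans hb1
    refine sum_abs_sub_le_of_hellinger _ (fun x _ => push_nonneg (ha x.1) _)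
      (fun x _ => mul_nonneg (push_nonneg hb _) (hκ0 _ _)) hP1 ?_ ?_
    · refine le_trans (le_of_eq ?_) hP1
      rw [Finset.sum_product, Finset.sum_product]
      exact Finset.sum_congr rfl fun m hm =>
        sum_mul_pushRatio (push_nonneg (ha m)) (push_le_push (hab1 m hm)) π
    · rw [Finset.sum_product]
      refine le_trans (Finset.sum_le_sum fun m hm => ?_) hD
      have := sum_sq_sqrt_sub_le_relEntropy_sub (push_nonneg (T := T) (ha m))
        (push_le_push (T := T) (hab1 m hm)) π
      rwa [push_push, push_push, hcomp] at this
  set Q : M → E → V → ℝ := fun m e v => ∑ f, b f * (κ m (view c S f) * I e v (T f)) with hQ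
  have step2 : ∑ m ∈ F, ∑ v, ∑ e,
      |push (fun f => (f i, ψ (view c S f))) (a m) (e, v) - Q m e v| ≤ 2 * √D := by
    refine le_trans (Finset.sum_le_sum fun m _ => ?_) step1
    have hQ' : ∀ e v, Q m e v = ∑ t, push T b t * κ m (π t) * I e v t := fun e v => by
      simp_rw [mul_assoc]
      rw [sum_push_mul T b (fun t => κ m (π t) * I e v t)]
      simp only [hQ, hπT]
    calc _ ≤ ∑ v, ∑ e, ∑ t, |push T (a m) t - push T b t * κ m (π t)| * I e v t := by
          refine Finset.sum_le_sum fun v _ => Finset.sum_le_sum fun e _ => ?_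
          rw [hs, hQ', ← Finset.sum_sub_distrib]
          refine (Finset.abs_sum_le_sum_abs _ _).trans (Finset.sum_le_sum fun t _ => ?_)
          rw [← sub_mul, abs_mul, abs_of_nonneg (hI0 e v t)]
      _ = ∑ t, |push T (a m) t - push T b t * κ m (π t)| * ∑ v, ∑ e, I e v t := by
          simp_rw [Finset.mul_sum]
          rw [Finset.sum_comm (s := (Finset.univ : Finset (Fin n → E ⊕ E')))]
          exact Finset.sum_congr rfl fun v _ => Finset.sum_comm
      _ ≤ _ := Finset.sum_le_sum fun t _ => mul_le_of_le_one_right (abs_nonneg _) (hI1 t)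
  -- Exchanging `b` for the product law costs at most `ε`, because the kernel and the indicators sum
  -- to at most one.
  have step3 : ∑ m ∈ F, ∑ v, ∑ e,
      |Q m e v - ∑ f : Fin n → E, (∏ j, r (f j)) * (κ m (view c S f) * I e v (T f))| ≤ ε := by
    calc _ ≤ ∑ m ∈ F, ∑ v, ∑ e, ∑ f, |b f - ∏ j, r (f j)| * (κ m (view c S f) * I e v (T f)) := by
          refine Finset.sum_le_sum fun m _ => Finset.sum_le_sum fun v _ =>
            Finset.sum_le_sum fun e _ => ?_
          simp only [hQ]
          rw [← Finset.sum_sub_distrib]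
          refine (Finset.abs_sum_le_sum_abs _ _).trans (Finset.sum_le_sum fun f _ => ?_)
          rw [← sub_mul, abs_mul, abs_of_nonneg (mul_nonneg (hκ0 _ _) (hI0 e v _))]
      _ = ∑ f, |b f - ∏ j, r (f j)| * ∑ m ∈ F, (κ m (view c S f) * ∑ v, ∑ e, I e v (T f)) := by
          simp_rw [Finset.mul_sum]
          rw [Finset.sum_comm (s := (Finset.univ : Finset (Fin n → E)))]
          refine Finset.sum_congr rfl fun m _ => ?_
          rw [Finset.sum_comm (s := (Finset.univ : Finset (Fin n → E)))]
          exact Finset.sum_congr rfl fun v _ => Finset.sum_comm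
      _ ≤ ∑ f, |b f - ∏ j, r (f j)| := by
          refine Finset.sum_le_sum fun f _ => mul_le_of_le_one_right (abs_nonneg _) ?_
          exact (Finset.sum_le_sum fun m _ =>
            mul_le_of_le_one_right (hκ0 _ _) (hI1 _)).trans (hκ1 _)
      _ ≤ ε := hε
  -- Average the kernel over product-distributed words whose `i`-th letter is overwritten by `e`; by
  -- `view_update_congr` the result depends on `e` only through `c e`.
  refine ⟨fun e m v => ∑ f : Fin n → E, (∏ j, r (f j)) *
    (κ m (view c S (Function.update f i e)) *
      if ψ (view c S (Function.update f i e)) = v then 1 else 0), fun e e' h => ?_, ?_⟩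
  · funext m v
    simp_rw [view_update_congr c hi _ h]
  · refine le_trans ?_ (add_le_add step2 step3)
    rw [← Finset.sum_add_distrib]
    refine Finset.sum_le_sum fun m _ => ?_
    rw [← Finset.sum_add_distrib]
    refine Finset.sum_le_sum fun v _ => ?_
    rw [← Finset.sum_add_distrib]
    refine Finset.sum_le_sum fun e _ => ?_
    refine le_trans (le_of_eq ?_) (abs_sub_le _ (Q m e v) _)
    congr 2
    rw [← sum_prod_mul_ite hr i (fun f => κ m (view c S f) * if ψ (view c S f) = v then 1 else 0)]
    refine Finset.sum_congr rfl fun f _ => ?_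
    rw [hIT]
    by_cases h1 : f i = e <;> by_cases h2 : ψ (view c S f) = v <;> simp [h1, h2]

end View

/-! ### The chain rule as a telescoping sum over views -/

lemma push_comp_equiv {α β γ : Type*} [Fintype α] [Fintype β] (e : α ≃ β) (T : α → γ) (a : β → ℝ) :
    push T (a ∘ e) = push (T ∘ e.symm) a := by
  classical
  funext s
  simp only [push]
  rw [← e.sum_comp]
  simp

lemma sum_abs_push_le {α β : Type*} [Fintype α] [Fintype β] (T : α → β) (w : α → ℝ) :
    ∑ s, |push T w s| ≤ ∑ t, |w t| := by
  classical
  rw [← sum_push T fun t => |w t|]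
  refine Finset.sum_le_sum fun s _ => (Finset.abs_sum_le_sum_abs _ _).trans (le_of_eq ?_)
  exact Finset.sum_congr rfl fun t _ => by split_ifs <;> simp

section Telescope

variable {E E' : Type*} [Fintype E] [Fintype E'] {n : ℕ}

/-- The coordinates are refined from the last to the first; `sum_view_Iio` uses the opposite order.
-/
lemma sum_view_Ioi (K : Set (Fin n) → ℝ) :
    ∑ i, (K (insert i (Set.Ioi i)) - K (Set.Ioi i)) = K Set.univ - K ∅ := by
  set G : ℕ → ℝ := fun k => K {j | k ≤ j.val} with hG
  have h : ∀ i : Fin n, K (insert i (Set.Ioi i)) - K (Set.Ioi i) = G i - G (i + 1) := fun i => by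
    simp only [hG]
    congr 2
    rw [Set.Ioi_insert]
    rfl
  simp_rw [h]
  rw [Fin.sum_univ_eq_sum_range (fun k => G k - G (k + 1)), Finset.sum_range_sub']
  simp only [hG]
  congr 2
  · ext j; simp
  · ext j; simp

lemma sum_view_Iio (K : Set (Fin n) → ℝ) :
    ∑ i, (K (insert i (Set.Iio i)) - K (Set.Iio i)) = K Set.univ - K ∅ := by
  set G : ℕ → ℝ := fun k => K {j | j.val < k} with hG
  have h : ∀ i : Fin n, K (insert i (Set.Iio i)) - K (Set.Iio i) = G (i + 1) - G i := fun i => by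
    simp only [hG]
    congr 2
    rw [Set.Iio_insert]
    ext j
    exact Nat.lt_succ_iff.symm
  simp_rw [h]
  rw [Fin.sum_univ_eq_sum_range (fun k => G (k + 1) - G k), Finset.sum_range_sub]
  simp only [hG]
  congr 2
  · ext j; simp
  · ext j; simp

lemma relEntropy_view_mono (c : E → E') {S : Set (Fin n)} {i : Fin n} (hi : i ∉ S)
    {a b : (Fin n → E) → ℝ} (ha : ∀ f, 0 ≤ a f) (hab : ∀ f, a f ≤ b f) :
    relEntropy (push (view c S) a) (push (view c S) b)
      ≤ relEntropy (push (view c (insert i S)) a) (push (view c (insert i S)) b) := by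
  have h := relEntropy_push_le (push_nonneg (T := view c (insert i S)) ha)
    (push_le_push hab) (coarsen c i)
  rwa [push_push, push_push,
    show coarsen c i ∘ view c (insert i S) = view c S from funext (coarsen_view_insert c hi)] at h

/-- The conditional mutual information dominates the contributions of finitely many transcripts
to the total increase of the relative entropy between the coarsest and the finest view. -/
lemma sum_view_le_condMutualInfo {M U W : Type*} [Fintype U] [Fintype W] (q : M → U → W → ℝ)
    (hq : ∀ m u w, 0 ≤ q m u w) (hs : ∀ u w, Summable fun m => q m u w)
    (e : U × W ≃ (Fin n → E)) {a : M → (Fin n → E) → ℝ} {b : (Fin n → E) → ℝ}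
    (ha : ∀ m t, a m (e t) = q m t.1 t.2) (hb : ∀ t, b (e t) = ∑' m, q m t.1 t.2)
    (c : E → E') (h : (Fin n → E') → W) (hh : ∀ f, h (fun j => c (f j)) = (e.symm f).2)
    (F : Finset M) :
    ∑ m ∈ F, ((relEntropy (push (view c Set.univ) (a m)) (push (view c Set.univ) b))
      - relEntropy (push (view c ∅) (a m)) (push (view c ∅) b)) ≤ condMutualInfo q := by
  have ha0 : ∀ m f, 0 ≤ a m f := fun m f => by
    rw [← e.apply_symm_apply f, ha]; exact hq _ _ _
  have hab : ∀ m f, a m f ≤ b f := fun m f => by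
    rw [← e.apply_symm_apply f, ha, hb]
    exact (hs _ _).le_tsum m fun _ _ => hq _ _ _
  refine le_trans (Finset.sum_le_sum fun m _ => ?_)
    (sum_le_hasSum F (fun m _ => relEntropy_sub_nonneg q hq hs m) (hasSum_condMutualInfo q hq hs))
  have hae : (fun t : U × W => q m t.1 t.2) = a m ∘ e := funext fun t => (ha m t).symm
  have hbe : (fun t : U × W => ∑' m, q m t.1 t.2) = b ∘ e := funext fun t => (hb t).symm
  refine sub_le_sub ?_ ?_
  · refine (relEntropy_push_le (ha0 m) (hab m) _).trans (le_of_eq ?_)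
    rw [hae, hbe]
    exact (e.sum_comp fun f => a m f * Real.log (a m f / b f)).symm
  -- The conditioning variable is a function of the coarsest view, so the subtracted term is bounded
  -- in the right direction by data processing.
  · set h' : (Fin n → E ⊕ E') → W := fun t => h fun j => Sum.elim c id (t j) with hh'
    have hcomp : h' ∘ view c ∅ = Prod.snd ∘ e.symm := by
      funext f
      simp [hh', view, hh]
    have h1 : (fun w => ∑ u, q m u w) = push h' (push (view c ∅) (a m)) := by
      rw [push_push, hcomp, ← push_comp_equiv, ← hae, push_snd]
    have h2 : (fun w => ∑' m, ∑ u, q m u w) = push h' (push (view c ∅) b) := by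
      rw [push_push, hcomp, ← push_comp_equiv, ← hbe, push_snd]
      funext w
      exact Summable.tsum_finsetSum fun u _ => hs u w
    rw [h1, h2]
    exact relEntropy_push_le (push_nonneg (ha0 m)) (push_le_push (hab m)) h'

end Telescope

/-! ### The single-letter auxiliary variable -/

section Letters

variable {X Y Z : Type*} {n : ℕ}

/-- Triples of words are words of triples. -/
def wordEquiv (X Y Z : Type*) (n : ℕ) :
    (Fin n → X) × (Fin n → Y) × (Fin n → Z) ≃ (Fin n → X × Y × Z) where
  toFun t j := (t.1 j, t.2.1 j, t.2.2 j)
  invFun f := (fun j => (f j).1, fun j => (f j).2.1, fun j => (f j).2.2)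
  left_inv _ := rfl
  right_inv _ := rfl

/-- The letters of `X` before the position `i` and the letters of `Y` after it. -/
def pastFuture (i : Fin n) (f : Fin n → X × Y × Z) : (Fin n → Option X) × (Fin n → Option Y) :=
  (fun j => if j < i then some (f j).1 else none, fun j => if i < j then some (f j).2.1 else none)

variable [Fintype X] [Fintype Y] [Fintype Z]

open scoped Classical in
/-- Alice's factor of the joint law of a letter and the auxiliary variable. -/
def factorX (P : Problem X Y Z) (i : Fin n) (α : (Fin n → X) → ℝ)
    (v : (Fin n → Option X) × (Fin n → Option Y)) (x₀ : X) : ℝ :=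
  ∑ x : Fin n → X, if x i = x₀ ∧ (fun j => if j < i then some (x j) else none) = v.1 then
    α x * ∏ j, (v.2 j).elim 1 (fun y => P.pXY (x j) y) else 0

open scoped Classical in
/-- Bob's factor of the joint law of a letter and the auxiliary variable. -/
def factorY (P : Problem X Y Z) (i : Fin n) (β : (Fin n → Y) → (Fin n → Z) → ℝ)
    (v : (Fin n → Option X) × (Fin n → Option Y)) (y₀ : Y) (z₀ : Z) : ℝ :=
  ∑ yz : (Fin n → Y) × (Fin n → Z), if (yz.1 i = y₀ ∧ yz.2 i = z₀) ∧
      (fun j => if i < j then some (yz.1 j) else none) = v.2 then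
    β yz.1 yz.2 * ∏ j, (v.1 j).elim 1 (fun x => P.pXY x (yz.1 j)) else 0

/-- For `j < i` the letter `x j` is recorded in `v`, so `p(x j, y j)` can be charged to Bob; for `j
> i` the letter `y j` is recorded and it is charged to Alice. Only `p(x₀, y₀)` remains. -/
lemma push_pastFuture (P : Problem X Y Z) (i : Fin n) (α : (Fin n → X) → ℝ)
    (β : (Fin n → Y) → (Fin n → Z) → ℝ) {a : (Fin n → X × Y × Z) → ℝ}
    (ha : ∀ x y z, a (wordEquiv X Y Z n (x, y, z)) = (∏ j, P.pXY (x j) (y j)) * (α x * β y z))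
    (v : (Fin n → Option X) × (Fin n → Option Y)) (x₀ : X) (y₀ : Y) (z₀ : Z) :
    push (fun f => (f i, pastFuture i f)) a ((x₀, y₀, z₀), v)
      = P.pXY x₀ y₀ * (factorX P i α v x₀ * factorY P i β v y₀ z₀) := by
  classical
  unfold push factorX factorY
  rw [← (wordEquiv X Y Z n).sum_comp, Fintype.sum_prod_type, Finset.sum_mul_sum, Finset.mul_sum]
  refine Finset.sum_congr rfl fun x _ => ?_
  rw [Finset.mul_sum]
  refine Finset.sum_congr rfl fun yz _ => ?_
  obtain ⟨y, z⟩ := yz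
  obtain ⟨v1, v2⟩ := v
  have hiff : ((wordEquiv X Y Z n (x, y, z)) i, pastFuture i (wordEquiv X Y Z n (x, y, z)))
      = ((x₀, y₀, z₀), (v1, v2)) ↔
      (x i = x₀ ∧ (fun j => if j < i then some (x j) else none) = v1) ∧
      ((y i = y₀ ∧ z i = z₀) ∧ (fun j => if i < j then some (y j) else none) = v2) := by
    simp only [wordEquiv, pastFuture, Equiv.coe_fn_mk, Prod.mk.injEq]
    tauto
  simp only [hiff]
  by_cases h1 : x i = x₀ ∧ (fun j => if j < i then some (x j) else none) = v1
  swap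
  · simp [h1]
  by_cases h2 : (y i = y₀ ∧ z i = z₀) ∧ (fun j => if i < j then some (y j) else none) = v2
  swap
  · simp [h2]
  rw [if_pos ⟨h1, h2⟩, if_pos h1, if_pos h2, ha]
  obtain ⟨rfl, rfl⟩ := h1
  obtain ⟨⟨rfl, rfl⟩, rfl⟩ := h2
  have hprod : ∏ j, P.pXY (x j) (y j) = P.pXY (x i) (y i)
      * (∏ j, (if i < j then some (y j) else none).elim 1 (fun y => P.pXY (x j) y))
      * ∏ j, (if j < i then some (x j) else none).elim 1 (fun x => P.pXY x (y j)) := by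
    have : P.pXY (x i) (y i) = ∏ j, if j = i then P.pXY (x j) (y j) else 1 := by simp
    rw [this, ← Finset.prod_mul_distrib, ← Finset.prod_mul_distrib]
    refine Finset.prod_congr rfl fun j _ => ?_
    rcases lt_trichotomy j i with h | h | h
    · simp [h, h.ne, h.not_gt]
    · simp [h]
    · simp [h, h.ne', h.not_gt]
  rw [hprod]
  ring

end Letters

/-! ### From block protocols to an almost secure variable -/

namespace Problem

variable {X Y Z : Type*} [Fintype X] [Fintype Y] [Fintype Z]

/-- The joint p.m.f. of inputs and output, as a function of the triple. -/
def triple (P : Problem X Y Z) (e : X × Y × Z) : ℝ := P.pXY e.1 e.2.1 * P.pZ e.1 e.2.1 e.2.2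

lemma sum_triple (P : Problem X Y Z) : ∑ e, P.triple e = 1 := by
  simp only [triple, Fintype.sum_prod_type, ← Finset.mul_sum, P.pZ_sum, mul_one, P.pXY_sum]

lemma sum_word_eq (n : ℕ) (G : (Fin n → X × Y × Z) → ℝ) :
    ∑ f, G f = ∑ x : Fin n → X, ∑ y : Fin n → Y, ∑ z : Fin n → Z,
      G (wordEquiv X Y Z n (x, y, z)) := by
  rw [← (wordEquiv X Y Z n).sum_comp]
  simp only [Fintype.sum_prod_type]

lemma prod_triple_wordEquiv (P : Problem X Y Z) (n : ℕ) (x : Fin n → X) (y : Fin n → Y)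
    (z : Fin n → Z) : ∏ j, P.triple (wordEquiv X Y Z n (x, y, z) j)
      = (P.block n).pXY x y * (P.block n).pZ x y z := Finset.prod_mul_distrib

lemma sum_prod_triple (P : Problem X Y Z) (n : ℕ) :
    ∑ f : Fin n → X × Y × Z, ∏ j, P.triple (f j) = 1 := by
  have h := (P.block n).sum_triple
  rw [sum_word_eq]
  simp only [prod_triple_wordEquiv]
  simpa only [triple, Fintype.sum_prod_type] using h

lemma push_eval_prod_triple (P : Problem X Y Z) {n : ℕ} (i : Fin n) (e : X × Y × Z) :
    push (fun f => f i) (fun f : Fin n → X × Y × Z => ∏ j, P.triple (f j)) e = P.triple e := by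
  classical
  have h := sum_prod_mul_ite P.sum_triple i (fun _ => 1) e
  simp only [mul_one, P.sum_prod_triple, mul_ite, mul_zero] at h
  rw [← h]
  unfold push
  exact Finset.sum_congr rfl fun f _ => by split_ifs <;> rfl

/-- From a protocol for blocks of positive length one obtains an almost secure auxiliary
variable for a single letter. -/
lemma exists_almostSecure (P : Problem X Y Z) {n : ℕ} (hn : 0 < n) {ε δ : ℝ} (hε : 0 < ε)
    (hδ : 2 * √(2 * ε) + 2 * ε ≤ δ) (prot : Protocol (Fin n → X) (Fin n → Y) (Fin n → Z))
    (hprot : P.SecureUpTo n ε prot) :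
    ∃ (F : Finset (Transcript × ((Fin n → Option X) × (Fin n → Option Y))))
      (A : Transcript × ((Fin n → Option X) × (Fin n → Option Y)) → X → ℝ)
      (B : Transcript × ((Fin n → Option X) × (Fin n → Option Y)) → Y → Z → ℝ)
      (g : X → Transcript × ((Fin n → Option X) × (Fin n → Option Y)) → ℝ)
      (h : Y → Z → Transcript × ((Fin n → Option X) × (Fin n → Option Y)) → ℝ),
      P.AlmostSecure δ F A B g h := by
  classical
  obtain ⟨herr, hlA, hlB⟩ := hprot
  obtain ⟨α, β, hα, hβ, hlaw⟩ := prot.exists_law_eq_mul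
  set w := wordEquiv X Y Z n with hw
  set a : Transcript → (Fin n → X × Y × Z) → ℝ := fun m f =>
    prot.joint (P.block n) (w.symm f).1 (w.symm f).2.1 m (w.symm f).2.2 with ha
  set b : (Fin n → X × Y × Z) → ℝ := fun f => ∑' m, a m f with hb
  have haw : ∀ m x y z, a m (w (x, y, z)) = prot.joint (P.block n) x y m z := fun m x y z => by
    simp only [ha, Equiv.symm_apply_apply]
  have hj0 : ∀ x y m z, 0 ≤ prot.joint (P.block n) x y m z := fun x y m z =>
    mul_nonneg ((P.block n).pXY_nonneg _ _) (prot.law_nonneg _ _ _ _)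
  have hjs : ∀ x y z, Summable fun m => prot.joint (P.block n) x y m z := fun x y z =>
    (prot.summable_law x y z).mul_left _
  have ha0 : ∀ m f, 0 ≤ a m f := fun m f => hj0 _ _ _ _
  have has : ∀ f, Summable fun m => a m f := fun f => hjs _ _ _
  have hbw : ∀ x y z, b (w (x, y, z)) = (P.block n).pXY x y * prot.outLaw x y z := fun x y z => by
    simp only [hb, haw]
    exact tsum_mul_left
  have hab : ∀ (F : Finset Transcript) f, ∑ m ∈ F, a m f ≤ b f := fun F f =>
    (has f).sum_le_tsum F fun m _ => ha0 m f
  have hab1 : ∀ m f, a m f ≤ b f := fun m f => (has f).le_tsum m fun m _ => ha0 m f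
  have hb1 : ∑ f, b f = 1 := by
    rw [sum_word_eq]
    simp only [← hw, hbw, ← Finset.mul_sum, prot.sum_outLaw, mul_one, (P.block n).pXY_sum]
  have hbr : ∑ f, |b f - ∏ j, P.triple (f j)| ≤ ε := by
    refine le_trans (le_of_eq ?_) herr
    rw [sum_word_eq]
    simp only [← hw, hbw]
    simp only [hw, prod_triple_wordEquiv, ← mul_sub, abs_mul,
      abs_of_nonneg ((P.block n).pXY_nonneg _ _), ← Finset.mul_sum]
    rfl
  -- finitely many transcripts carry almost all the mass
  have hsum : HasSum (fun m => ∑ f, a m f) (∑ f, b f) := hasSum_sum fun f _ => (has f).hasSum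
  obtain ⟨F, hF⟩ := (Metric.tendsto_nhds.1 hsum ε hε).exists
  -- a coordinate with small leakage
  set cA : X × Y × Z → X := Prod.fst with hcA
  set cB : X × Y × Z → Y × Z := Prod.snd with hcB
  set KA : Set (Fin n) → ℝ := fun S =>
    ∑ m ∈ F, relEntropy (push (view cA S) (a m)) (push (view cA S) b) with hKA
  set KB : Set (Fin n) → ℝ := fun S =>
    ∑ m ∈ F, relEntropy (push (view cB S) (a m)) (push (view cB S) b) with hKB
  have hA : ∑ i, (KA (insert i (Set.Ioi i)) - KA (Set.Ioi i)) ≤ n * ε := by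
    rw [sum_view_Ioi]
    refine le_trans ?_ hlA
    simp only [hKA]
    rw [← Finset.sum_sub_distrib]
    exact sum_view_le_condMutualInfo
      (fun (m : Transcript) (bc : (Fin n → Y) × (Fin n → Z)) (x : Fin n → X) =>
        prot.joint (P.block n) x bc.1 m bc.2) (fun _ _ _ => hj0 _ _ _ _) (fun _ _ => hjs _ _ _)
      ((Equiv.prodComm _ _).trans w) (fun m t => haw m t.2 t.1.1 t.1.2)
      (fun t => tsum_congr fun m => haw m t.2 t.1.1 t.1.2) cA id (fun f => rfl) F
  have hB : ∑ i, (KB (insert i (Set.Iio i)) - KB (Set.Iio i)) ≤ n * ε := by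
    rw [sum_view_Iio]
    refine le_trans ?_ hlB
    simp only [hKB]
    rw [← Finset.sum_sub_distrib]
    exact sum_view_le_condMutualInfo
      (fun (m : Transcript) (x : Fin n → X) (bc : (Fin n → Y) × (Fin n → Z)) =>
        prot.joint (P.block n) x bc.1 m bc.2) (fun _ _ _ => hj0 _ _ _ _) (fun _ _ => hjs _ _ _)
      w (fun m t => haw m t.1 t.2.1 t.2.2)
      (fun t => tsum_congr fun m => haw m t.1 t.2.1 t.2.2) cB
      (fun f => (fun j => (f j).1, fun j => (f j).2)) (fun f => rfl) F
  -- Averaging the sum of both increments gives one coordinate for both users; as neither is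
  -- negative, each is at most `2 * ε`.
  obtain ⟨i, -, hi⟩ : ∃ i ∈ (Finset.univ : Finset (Fin n)),
      (KA (insert i (Set.Ioi i)) - KA (Set.Ioi i)) + (KB (insert i (Set.Iio i)) - KB (Set.Iio i))
        ≤ 2 * ε := by
    refine Finset.exists_le_of_sum_le ⟨⟨0, hn⟩, Finset.mem_univ _⟩ ?_
    rw [Finset.sum_add_distrib]
    simp only [Finset.sum_const, Finset.card_univ, Fintype.card_fin, nsmul_eq_mul]
    linarith
  have hAi0 : 0 ≤ KA (insert i (Set.Ioi i)) - KA (Set.Ioi i) := sub_nonneg.2 <|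
    Finset.sum_le_sum fun m _ => relEntropy_view_mono cA (by simp) (ha0 m) (hab1 m)
  have hBi0 : 0 ≤ KB (insert i (Set.Iio i)) - KB (Set.Iio i) := sub_nonneg.2 <|
    Finset.sum_le_sum fun m _ => relEntropy_view_mono cB (by simp) (ha0 m) (hab1 m)
  -- the decoupling estimates
  obtain ⟨GA, hGA, hGA'⟩ := exists_coarse_approx F ha0 (hab F) hb1.le P.sum_triple hbr cA
    (S := Set.Ioi i) (i := i) (by simp) (D := 2 * ε)
    (by rw [Finset.sum_sub_distrib]; linarith)
    (fun t => (fun j => if j < i then some (Sum.elim Prod.fst id (t j)) else none,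
      fun j => if i < j then Sum.elim (fun e => some e.2.1) (fun _ => none) (t j) else none))
  obtain ⟨GB, hGB, hGB'⟩ := exists_coarse_approx F ha0 (hab F) hb1.le P.sum_triple hbr cB
    (S := Set.Iio i) (i := i) (by simp) (D := 2 * ε)
    (by rw [Finset.sum_sub_distrib]; linarith)
    (fun t => (fun j => if j < i then Sum.elim (fun e => some e.1) (fun _ => none) (t j) else none,
      fun j => if i < j then some (Sum.elim (fun e => e.2.1) Prod.fst (t j)) else none))
  -- Each view determines `X_{<i}` and `Y_{>i}`; the `none` branches on coarse letters are never
  -- reached.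
  have hψA : ∀ f : Fin n → X × Y × Z,
      ((fun j => if j < i then some (Sum.elim Prod.fst id (view cA (Set.Ioi i) f j)) else none,
        fun j => if i < j then Sum.elim (fun e => some e.2.1) (fun _ => none)
          (view cA (Set.Ioi i) f j) else none) : (Fin n → Option X) × (Fin n → Option Y))
      = pastFuture i f := fun f => by
    unfold pastFuture view
    refine Prod.ext (funext fun j => ?_) (funext fun j => ?_)
    · by_cases h : j < i
      · simp [h, h.not_gt, hcA]
      · simp [h]
    · by_cases h : i < j <;> simp [h]
  have hψB : ∀ f : Fin n → X × Y × Z,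
      ((fun j => if j < i then Sum.elim (fun e => some e.1) (fun _ => none)
          (view cB (Set.Iio i) f j) else none,
        fun j => if i < j then some (Sum.elim (fun e => e.2.1) Prod.fst
          (view cB (Set.Iio i) f j)) else none) : (Fin n → Option X) × (Fin n → Option Y))
      = pastFuture i f := fun f => by
    unfold pastFuture view
    refine Prod.ext (funext fun j => ?_) (funext fun j => ?_)
    · by_cases h : j < i <;> simp [h]
    · by_cases h : i < j
      · simp [h, h.not_gt, hcB]
      · simp [h]
  simp only [hψA] at hGA'
  simp only [hψB] at hGB'
  have hfac : ∀ m v x y z, push (fun f => (f i, pastFuture i f)) (a m) ((x, y, z), v)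
      = P.pXY x y * (factorX P i (fun x => α x m) v x * factorY P i (fun y z => β y m z) v y z) :=
    fun m v x y z => push_pastFuture P i (fun x => α x m) (fun y z => β y m z)
      (fun x y z => by rw [← hw, haw, Protocol.joint, hlaw]; rfl) v x y z
  -- A dummy triple: `GA` depends only on `x` and `GB` only on `(y, z)`, so the other entries can be
  -- arbitrary.
  obtain ⟨e₀⟩ : Nonempty (X × Y × Z) := by
    by_contra h
    rw [not_nonempty_iff] at h
    have := P.sum_triple
    simp at this
  refine ⟨F ×ˢ Finset.univ, fun u => factorX P i (fun x => α x u.1) u.2,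
    fun u => factorY P i (fun y z => β y u.1 z) u.2, fun x u => GA (x, e₀.2) u.1 u.2,
    fun y z u => GB (e₀.1, y, z) u.1 u.2, fun u y z => ?_, fun x y z => ?_, fun x y z => ?_,
    fun x y => ?_⟩
  · refine Finset.sum_nonneg fun yz _ => ?_
    split_ifs
    · refine mul_nonneg (hβ _ _ _) (Finset.prod_nonneg fun j _ => ?_)
      cases u.2.1 j
      · exact zero_le_one
      · exact P.pXY_nonneg _ _
    · exact le_rfl
  · refine le_trans ?_ ((hGA'.trans (by linarith)).trans hδ)
    rw [Finset.sum_product]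
    refine Finset.sum_le_sum fun m _ => Finset.sum_le_sum fun v _ => ?_
    dsimp only
    rw [← hfac, hGA (x, e₀.2) (x, y, z) rfl]
    exact Finset.single_le_sum (f := fun e => |push (fun f => (f i, pastFuture i f)) (a m) (e, v)
      - P.triple e * GA e m v|) (fun _ _ => abs_nonneg _) (Finset.mem_univ (x, y, z))
  · refine le_trans ?_ ((hGB'.trans (by linarith)).trans hδ)
    rw [Finset.sum_product]
    refine Finset.sum_le_sum fun m _ => Finset.sum_le_sum fun v _ => ?_
    dsimp only
    rw [← hfac, hGB (e₀.1, y, z) (x, y, z) rfl]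
    exact Finset.single_le_sum (f := fun e => |push (fun f => (f i, pastFuture i f)) (a m) (e, v)
      - P.triple e * GB e m v|) (fun _ _ => abs_nonneg _) (Finset.mem_univ (x, y, z))
  · have hmarg : ∀ m e, ∑ v, push (fun f => (f i, pastFuture i f)) (a m) (e, v)
        = push (fun f => f i) (a m) e := fun m e => by
      rw [← congr_fun push_fst e, push_push]
      rfl
    -- One `ε` for the truncation to `F`, one for the output error.
    have hd : ∑ f, |∑ m ∈ F, a m f - ∏ j, P.triple (f j)| ≤ 2 * ε := by
      have h1 : ∑ f, |∑ m ∈ F, a m f - b f| ≤ ε := by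
        have : ∀ f, |∑ m ∈ F, a m f - b f| = b f - ∑ m ∈ F, a m f := fun f => by
          rw [abs_sub_comm, abs_of_nonneg (sub_nonneg.2 (hab F f))]
        simp_rw [this]
        rw [Finset.sum_sub_distrib, Finset.sum_comm]
        rw [dist_comm, Real.dist_eq] at hF
        exact (le_abs_self _).trans hF.le
      calc _ ≤ ∑ f, (|∑ m ∈ F, a m f - b f| + |b f - ∏ j, P.triple (f j)|) :=
            Finset.sum_le_sum fun f _ => abs_sub_le _ _ _
        _ ≤ 2 * ε := by rw [Finset.sum_add_distrib]; linarith
    have hsq : 0 ≤ √(2 * ε) := Real.sqrt_nonneg _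
    refine le_trans ?_ ((hd.trans (by linarith)).trans hδ)
    refine le_trans ?_ (sum_abs_push_le (fun f : Fin n → X × Y × Z => f i) _)
    have hlhs : ∑ u ∈ F ×ˢ (Finset.univ : Finset ((Fin n → Option X) × (Fin n → Option Y))),
        ∑ z, P.pXY x y * (factorX P i (fun x => α x u.1) u.2 x
          * factorY P i (fun y z => β y u.1 z) u.2 y z) - P.pXY x y
        = ∑ z, push (fun f => f i)
          (fun f => ∑ m ∈ F, a m f - ∏ j, P.triple (f j)) (x, y, z) := by
      have hsub : ∀ e, push (fun f => f i) (fun f => ∑ m ∈ F, a m f - ∏ j, P.triple (f j)) e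
          = ∑ m ∈ F, push (fun f => f i) (a m) e - P.triple e := fun e => by
        rw [← push_sum, ← P.push_eval_prod_triple i e]
        simp only [push]
        rw [← Finset.sum_sub_distrib]
        exact Finset.sum_congr rfl fun f _ => by split_ifs <;> simp
      simp only [hsub]
      rw [Finset.sum_sub_distrib, Finset.sum_product]
      congr 1
      · simp only [← hfac]
        rw [Finset.sum_comm (s := (Finset.univ : Finset Z)) (t := F)]
        refine Finset.sum_congr rfl fun m _ => ?_
        rw [Finset.sum_comm]
        exact Finset.sum_congr rfl fun z _ => hmarg m _
      · simp only [triple]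
        rw [← Finset.mul_sum, P.pZ_sum, mul_one]
    rw [hlhs]
    refine (Finset.abs_sum_le_sum_abs _ _).trans ?_
    rw [Fintype.sum_prod_type]
    refine le_trans ?_ (Finset.single_le_sum (f := fun x => ∑ yz, |push (fun f => f i)
      (fun f => ∑ m ∈ F, a m f - ∏ j, P.triple (f j)) (x, yz)|) (fun _ _ => Finset.sum_nonneg
        fun _ _ => abs_nonneg _) (Finset.mem_univ x))
    rw [Fintype.sum_prod_type]
    exact Finset.single_le_sum (f := fun y => ∑ z, |push (fun f => f i)
      (fun f => ∑ m ∈ F, a m f - ∏ j, P.triple (f j)) (x, y, z)|) (fun _ _ => Finset.sum_nonneg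
        fun _ _ => abs_nonneg _) (Finset.mem_univ y)

/-- Asymptotic security implies that the classes are column monochromatic. -/
theorem columnMonochromatic_of_asymptoticallyComputable (P : Problem X Y Z)
    (hP : P.AsymptoticallyComputable) :
    ∀ C ∈ P.chainSetoid.classes, P.ColumnMonochromatic C Set.univ := by
  refine P.columnMonochromatic_of_almostSecure fun δ hδ => ?_
  -- Each of the two terms in `h1` becomes at most `δ / 2`.
  set ε := min (δ / 4) (δ ^ 2 / 32) with hε
  have hε0 : 0 < ε := lt_min (by positivity) (by positivity)
  have h1 : 2 * √(2 * ε) + 2 * ε ≤ δ := by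
    have h2 : √(2 * ε) ≤ δ / 4 := by
      rw [Real.sqrt_le_left (by positivity)]
      linarith [min_le_right (δ / 4) (δ ^ 2 / 32)]
    linarith [min_le_left (δ / 4) (δ ^ 2 / 32)]
  obtain ⟨n, hn, prot, hprot⟩ := hP ε hε0 1
  exact ⟨_, P.exists_almostSecure hn hε0 h1 prot hprot⟩

end Problem

/-! ### The one-message protocol -/

namespace Problem

variable {X Y Z : Type*} [Fintype X] [Fintype Y] [Fintype Z]

/-- An encoding of Alice's input by which both security and correctness of the protocol that just
sends the code word are ensured. -/
structure SecureCode (P : Problem X Y Z) {l : ℕ} (g : X → Fin l → Bool) : Prop where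
  eq_of_confusable : ∀ x x', P.Confusable x x' → g x = g x'
  pZ_eq : ∀ x x' y, g x = g x' → 0 < P.pXY x y → 0 < P.pXY x' y → P.pZ x y = P.pZ x' y

-- The code word is the indicator vector of the class of `x`, one bit per element of `X`. It is
-- wasteful, but it has fixed length and some finite rate is enough.
open scoped Classical in
lemma secureCode_of_columnMonochromatic (P : Problem X Y Z)
    (hP : ∀ C ∈ P.chainSetoid.classes, P.ColumnMonochromatic C Set.univ) :
    P.SecureCode fun x (k : Fin (Fintype.card X)) =>
      decide (P.chainSetoid.r ((Fintype.equivFin X).symm k) x) := by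
  constructor
  · intro x x' h
    have hxx' : P.chainSetoid.r x x' := Relation.ReflTransGen.single h
    funext k
    rw [decide_eq_decide]
    exact ⟨fun h => P.chainSetoid.trans h hxx',
      fun h => P.chainSetoid.trans h (P.chainSetoid.symm hxx')⟩
  · intro x x' y h hx hx'
    have h1 := congr_fun h (Fintype.equivFin X x)
    simp only [Equiv.symm_apply_apply, decide_eq_decide] at h1
    have h2 : P.chainSetoid.r x x' := h1.1 (P.chainSetoid.refl x)
    rcases eq_or_ne x x' with rfl | hne
    · rfl
    funext z
    exact hP {a | P.chainSetoid.r a x'} ⟨x', rfl⟩ y (Set.mem_univ y) x h2 x'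
      (P.chainSetoid.refl x') hne hx hx' z

/-- Confusable words have equal or confusable letters in every position, so concatenated code words
work and the classes of the block problem need not be determined. -/
lemma SecureCode.block {P : Problem X Y Z} {l : ℕ} {g : X → Fin l → Bool} (hg : P.SecureCode g)
    (n : ℕ) : (P.block n).SecureCode fun x (k : Fin (n * l)) =>
      g (x (finProdFinEquiv.symm k).1) (finProdFinEquiv.symm k).2 := by
  have hpos : ∀ (p : Fin n → ℝ), (∀ i, 0 ≤ p i) → 0 < ∏ i, p i → ∀ i, 0 < p i := fun p h0 h i =>
    (h0 i).lt_of_ne fun h1 => h.ne' (Finset.prod_eq_zero (Finset.mem_univ i) h1.symm)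
  constructor
  · rintro x x' ⟨-, y, z, h1, h2, h3, h4⟩
    have e : ∀ i, g (x i) = g (x' i) := fun i => by
      rcases eq_or_ne (x i) (x' i) with h | h
      · rw [h]
      · exact hg.eq_of_confusable _ _ ⟨h, y i, z i,
          hpos _ (fun i => P.pXY_nonneg _ _) h1 i, hpos _ (fun i => P.pXY_nonneg _ _) h2 i,
          hpos _ (fun i => P.pZ_nonneg _ _ _) h3 i, hpos _ (fun i => P.pZ_nonneg _ _ _) h4 i⟩
    funext k
    rw [e]
  · intro x x' y h h1 h2
    funext z
    change ∏ i, P.pZ (x i) (y i) (z i) = ∏ i, P.pZ (x' i) (y i) (z i)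
    refine Finset.prod_congr rfl fun i _ => ?_
    have e : g (x i) = g (x' i) := by
      funext k
      simpa using congr_fun h (finProdFinEquiv (i, k))
    rw [hg.pZ_eq _ _ _ e (hpos _ (fun i => P.pXY_nonneg _ _) h1 i)
      (hpos _ (fun i => P.pXY_nonneg _ _) h2 i)]

lemma nonempty_input (P : Problem X Y Z) : Nonempty X := by
  by_contra h
  rw [not_nonempty_iff] at h
  simpa using P.pXY_sum

open scoped Classical in
/-- Some input of Alice with the given code word that is compatible with `y`. -/
def representative (P : Problem X Y Z) {l : ℕ} (g : X → Fin l → Bool) (u : Message) (y : Y) : X :=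
  if h : ∃ x, List.ofFn (g x) = u ∧ 0 < P.pXY x y then h.choose else P.nonempty_input.some

lemma SecureCode.pZ_representative {P : Problem X Y Z} {l : ℕ} {g : X → Fin l → Bool}
    (hg : P.SecureCode g) {x : X} {y : Y} (h : 0 < P.pXY x y) :
    P.pZ (P.representative g (List.ofFn (g x)) y) y = P.pZ x y := by
  have hex : ∃ x', List.ofFn (g x') = List.ofFn (g x) ∧ 0 < P.pXY x' y := ⟨x, rfl, h⟩
  unfold representative
  rw [dif_pos hex]
  exact hg.pZ_eq _ _ _ (List.ofFn_injective hex.choose_spec.1) hex.choose_spec.2 h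

/-- The output distribution for the `k`-th pair of inputs, as a measure on a finite ordinal. -/
def outMeasure (P : Problem X Y Z) (k : Fin (Fintype.card (X × Y))) :
    Measure (Fin (Fintype.card Z)) :=
  ∑ z, ENNReal.ofReal (P.pZ ((Fintype.equivFin (X × Y)).symm k).1
    ((Fintype.equivFin (X × Y)).symm k).2 z) • Measure.dirac (Fintype.equivFin Z z)

instance (P : Problem X Y Z) (k : Fin (Fintype.card (X × Y))) :
    IsProbabilityMeasure (P.outMeasure k) := by
  constructor
  simp only [outMeasure, Measure.coe_finsetSum, Finset.sum_apply, Measure.smul_apply,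
    measure_univ, smul_eq_mul, mul_one]
  rw [← ENNReal.ofReal_sum_of_nonneg fun z _ => P.pZ_nonneg _ _ _, P.pZ_sum]
  simp

lemma outMeasure_singleton (P : Problem X Y Z) (x : X) (y : Y) (z : Z) :
    P.outMeasure (Fintype.equivFin (X × Y) (x, y)) {Fintype.equivFin Z z}
      = ENNReal.ofReal (P.pZ x y z) := by
  classical
  simp only [outMeasure, Measure.coe_finsetSum, Finset.sum_apply, Measure.smul_apply,
    smul_eq_mul, Equiv.symm_apply_apply]
  rw [Finset.sum_eq_single z]
  · simp
  · intro z' _ hz'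
    simp [hz']
  · simp

/-- The protocol in which Alice sends a code word for her input and Bob then samples from the
output distribution of a compatible input pair. -/
def oneMessage (P : Problem X Y Z) {l : ℕ} (g : X → Fin l → Bool) : Protocol X Y Z where
  ΩA := Unit
  -- Bob draws in advance an independent output for every input pair. The `Fin` types keep the space
  -- in `Type`, whatever the universes of `X`, `Y`, `Z`.
  ΩB := Fin (Fintype.card (X × Y)) → Fin (Fintype.card Z)
  μA := Measure.dirac ()
  μB := Measure.pi P.outMeasure
  turn h := if h = [] then some Party.alice else none
  code _ := {u | u.length = l}
  msgA x _ _ := List.ofFn (g x)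
  msgB _ _ _ := []
  out y r m := (Fintype.equivFin Z).symm
    (r (Fintype.equivFin (X × Y) (P.representative g m.flatten y, y)))
  code_prefixFree _ _ hu _ hv h := h.eq_of_length (hu.trans hv.symm)
  msgA_mem _ _ _ _ := List.length_ofFn
  msgB_mem _ _ h hh := by split_ifs at hh; simp at hh
  msgA_measurable _ _ _ := MeasurableSet.of_discrete
  msgB_measurable _ _ _ := MeasurableSet.of_discrete
  out_measurable _ _ _ := MeasurableSet.of_discrete
  halts a b := ae_of_all _ fun r => ⟨1, by simp [transcriptAfter]⟩

open scoped Classical in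
lemma law_oneMessage (P : Problem X Y Z) {l : ℕ} (g : X → Fin l → Bool) (x : X) (y : Y)
    (m : Transcript) (z : Z) : (P.oneMessage g).law x y m z =
      if m = [List.ofFn (g x)] then P.pZ (P.representative g (List.ofFn (g x)) y) y z else 0 := by
  have hT : ∀ r : (P.oneMessage g).ΩA × (P.oneMessage g).ΩB,
      ((P.oneMessage g).turn m = none ∧ (∃ k, transcriptAfter (P.oneMessage g).turn
        ((P.oneMessage g).msgA x r.1) ((P.oneMessage g).msgB y r.2) k = m) ↔
        m = [List.ofFn (g x)]) := by
    intro r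
    have h1 : transcriptAfter (P.oneMessage g).turn
        ((P.oneMessage g).msgA x r.1) ((P.oneMessage g).msgB y r.2) 1 = [List.ofFn (g x)] := by
      simp [transcriptAfter, oneMessage]
    have h2 : (P.oneMessage g).turn [List.ofFn (g x)] = none := by simp [oneMessage]
    constructor
    · rintro ⟨hm, k, hk⟩
      rcases k with _ | k
      · subst hk
        simp [oneMessage, transcriptAfter] at hm
      · rw [← hk, add_comm, Protocol.transcriptAfter_add _ _ _ (by rw [h1, h2]), h1]
    · rintro rfl
      exact ⟨h2, 1, h1⟩
  unfold Protocol.law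
  split_ifs with hm
  · subst hm
    have hset : {r : (P.oneMessage g).ΩA × (P.oneMessage g).ΩB |
        (P.oneMessage g).turn [List.ofFn (g x)] = none ∧
        (∃ k, transcriptAfter (P.oneMessage g).turn
          ((P.oneMessage g).msgA x r.1) ((P.oneMessage g).msgB y r.2) k = [List.ofFn (g x)]) ∧
        (P.oneMessage g).out y r.2 [List.ofFn (g x)] = z}
        = Set.univ ×ˢ {r | (P.oneMessage g).out y r [List.ofFn (g x)] = z} := by
      ext r
      rw [Set.mem_ofPred_eq, ← and_assoc, hT r]
      simp
    rw [hset, measureReal_prod_prod, probReal_univ, one_mul]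
    have hpre : {r : Fin (Fintype.card (X × Y)) → Fin (Fintype.card Z) |
        (Fintype.equivFin Z).symm (r (Fintype.equivFin (X × Y)
          (P.representative g [List.ofFn (g x)].flatten y, y))) = z}
        = Function.eval (β := fun _ => Fin (Fintype.card Z))
          (Fintype.equivFin (X × Y) (P.representative g (List.ofFn (g x)) y, y)) ⁻¹'
          {Fintype.equivFin Z z} := by
      ext r
      simp [Equiv.symm_apply_eq]
    change (Measure.pi P.outMeasure).real {r | (Fintype.equivFin Z).symm (r (Fintype.equivFin
      (X × Y) (P.representative g [List.ofFn (g x)].flatten y, y))) = z} = _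
    rw [hpre, measureReal_def, (measurePreserving_eval P.outMeasure _).measure_preimage
      MeasurableSet.of_discrete.nullMeasurableSet, outMeasure_singleton,
      ENNReal.toReal_ofReal (P.pZ_nonneg _ _ _)]
  · convert measureReal_empty
    ext r
    have := hT r
    simp only [Set.mem_ofPred_eq, Set.mem_empty_iff_false, iff_false]
    tauto

-- The representative yields the law for `x` itself where `pXY x y > 0`; elsewhere both sides
-- vanish.
open scoped Classical in
lemma SecureCode.joint_oneMessage {P : Problem X Y Z} {l : ℕ} {g : X → Fin l → Bool}
    (hg : P.SecureCode g) (x : X) (y : Y) (m : Transcript) (z : Z) :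
    (P.oneMessage g).joint P x y m z =
      if m = [List.ofFn (g x)] then P.pXY x y * P.pZ x y z else 0 := by
  unfold Protocol.joint
  rw [law_oneMessage]
  rcases (P.pXY_nonneg x y).eq_or_lt with h | h
  · simp [← h]
  · rw [hg.pZ_representative h]
    simp

/-- The transcript is a function of `x`, and on the support also of `(y, z)`, which gives the two
Markov chains. -/
theorem SecureCode.perfectlySecure {P : Problem X Y Z} {l : ℕ} {g : X → Fin l → Bool}
    (hg : P.SecureCode g) : (P.oneMessage g).PerfectlySecure P := by
  classical
  refine ⟨fun x y h z => ?_, fun m x yz => ?_, fun m yz x => ?_⟩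
  · unfold Protocol.outLaw
    simp_rw [law_oneMessage, hg.pZ_representative h]
    exact tsum_ite_eq _ _
  · simp only [hg.joint_oneMessage, tsum_fintype]
    by_cases hm : m = [List.ofFn (g x)]
    · subst hm
      simp only [if_true]
      rw [tsum_ite_eq, mul_comm]
      congr 1
      rw [tsum_eq_single [List.ofFn (g x)] (by intro m hm; simp [hm])]
      simp
    · simp [hm]
  · simp only [hg.joint_oneMessage, tsum_fintype]
    obtain ⟨y, z⟩ := yz
    have hsw : ∀ F : X → ℝ, ∑' m : Transcript, ∑ x, (if m = [List.ofFn (g x)] then F x else 0)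
        = ∑ x, F x := fun F => by
      rw [Summable.tsum_finsetSum fun x _ => summable_of_hasFiniteSupport
        ((Set.finite_singleton [List.ofFn (g x)]).subset fun m hm => by
          by_contra h; exact hm (if_neg h))]
      simp
    rw [hsw, tsum_ite_eq]
    dsimp only
    -- all inputs compatible with `(y, z)` have the same code word
    rcases (mul_nonneg (P.pXY_nonneg x y) (P.pZ_nonneg x y z)).eq_or_lt with h0 | hpos
    · simp [← h0]
    have hco : ∀ x', P.pXY x' y * P.pZ x' y z ≠ 0 → g x' = g x := fun x' hx' => by
      rcases eq_or_ne x' x with rfl | hne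
      · rfl
      have p1 := (mul_ne_zero_iff.1 hx')
      have p2 := (mul_ne_zero_iff.1 hpos.ne')
      exact hg.eq_of_confusable _ _ ⟨hne, y, z, (P.pXY_nonneg _ _).lt_of_ne' p1.1,
        (P.pXY_nonneg _ _).lt_of_ne' p2.1, (P.pZ_nonneg _ _ _).lt_of_ne' p1.2,
        (P.pZ_nonneg _ _ _).lt_of_ne' p2.2⟩
    have hsum : ∑ x', (if m = [List.ofFn (g x')] then P.pXY x' y * P.pZ x' y z else 0)
        = ∑ x', (if m = [List.ofFn (g x)] then P.pXY x' y * P.pZ x' y z else 0) := by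
      refine Finset.sum_congr rfl fun x' _ => ?_
      by_cases hx' : P.pXY x' y * P.pZ x' y z = 0
      · simp [hx']
      · rw [hco x' hx']
    rw [hsum]
    split_ifs
    · ring
    · simp

/-- Perfect security means no error and no leakage. -/
theorem error_leak_eq_zero_of_perfectlySecure {A B C : Type*} [Fintype A] [Fintype B] [Fintype C]
    {P : Problem A B C} {prot : Protocol A B C} (h : prot.PerfectlySecure P) :
    prot.error P = 0 ∧ prot.leakAlice P = 0 ∧ prot.leakBob P = 0 := by
  have hj0 : ∀ x y m z, 0 ≤ prot.joint P x y m z := fun x y m z =>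
    mul_nonneg (P.pXY_nonneg _ _) (prot.law_nonneg _ _ _ _)
  have hjs : ∀ x y z, Summable fun m => prot.joint P x y m z := fun x y z =>
    (prot.summable_law x y z).mul_left _
  refine ⟨?_, condMutualInfo_eq_zero _ (fun _ _ _ => hj0 _ _ _ _) (fun _ _ => hjs _ _ _) h.2.1,
    condMutualInfo_eq_zero _ (fun _ _ _ => hj0 _ _ _ _) (fun _ _ => hjs _ _ _) h.2.2⟩
  refine Finset.sum_eq_zero fun x _ => Finset.sum_eq_zero fun y _ => ?_
  rcases (P.pXY_nonneg x y).eq_or_lt with h0 | hpos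
  · simp [← h0]
  · simp [h.1 x y hpos]

lemma SecureCode.expectedLength {P : Problem X Y Z} {l : ℕ} {g : X → Fin l → Bool}
    (hg : P.SecureCode g) : (P.oneMessage g).expectedLength P = l := by
  classical
  unfold Protocol.expectedLength
  have h : ∀ (m : Transcript) (x : X) (y : Y) (z : Z),
      ENNReal.ofReal ((P.oneMessage g).joint P x y m z) * (m.flatten.length : ENNReal)
      = if m = [List.ofFn (g x)] then ENNReal.ofReal (P.pXY x y * P.pZ x y z) * l else 0 := by
    intro m x y z
    rw [hg.joint_oneMessage]
    split_ifs with hm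
    · subst hm; simp
    · simp
  simp_rw [h]
  simp_rw [← tsum_fintype (L := SummationFilter.unconditional _)]
  rw [ENNReal.tsum_comm]
  simp_rw [ENNReal.tsum_comm (α := Transcript), tsum_ite_eq, tsum_fintype]
  simp_rw [← Finset.sum_mul]
  have : ∑ x, ∑ y, ∑ z, ENNReal.ofReal (P.pXY x y * P.pZ x y z) = 1 := by
    have h1 : ∀ x y, ∑ z, ENNReal.ofReal (P.pXY x y * P.pZ x y z)
        = ENNReal.ofReal (P.pXY x y) := fun x y => by
      rw [← ENNReal.ofReal_sum_of_nonneg fun z _ =>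
        mul_nonneg (P.pXY_nonneg _ _) (P.pZ_nonneg _ _ _), ← Finset.mul_sum, P.pZ_sum, mul_one]
    simp_rw [h1]
    have h2 : ∀ x, ∑ y, ENNReal.ofReal (P.pXY x y) = ENNReal.ofReal (∑ y, P.pXY x y) := fun x =>
      (ENNReal.ofReal_sum_of_nonneg fun y _ => P.pXY_nonneg _ _).symm
    simp_rw [h2]
    rw [← ENNReal.ofReal_sum_of_nonneg fun x _ => Finset.sum_nonneg fun y _ => P.pXY_nonneg _ _,
      P.pXY_sum, ENNReal.ofReal_one]
  rw [this, one_mul]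

theorem SecureCode.achievableRate {P : Problem X Y Z} {l : ℕ} {g : X → Fin l → Bool}
    (hg : P.SecureCode g) : P.AchievableRate l := by
  refine ⟨fun n => (P.block n).oneMessage fun x (k : Fin (n * l)) =>
      g (x (finProdFinEquiv.symm k).1) (finProdFinEquiv.symm k).2, ?_, fun ε hε => ?_⟩
  · refine tendsto_const_nhds.congr' ?_
    -- The quotient equals `l` only for `n > 0`, where the factor `n` cancels.
    filter_upwards [eventually_gt_atTop 0] with n hn
    rw [(hg.block n).expectedLength, Nat.cast_mul, mul_comm]
    rw [ENNReal.mul_div_cancel_right (by exact_mod_cast hn.ne') (ENNReal.natCast_ne_top n)]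
    simp
  · refine Eventually.of_forall fun n => ?_
    obtain ⟨h1, h2, h3⟩ := error_leak_eq_zero_of_perfectlySecure (hg.block n).perfectlySecure
    have : 0 ≤ n * ε := by positivity
    exact ⟨h1.trans_le hε.le, h2.trans_le this, h3.trans_le this⟩

end Problem

end

theorem mainTheorem1 {X Y Z : Type*} [Fintype X] [Fintype Y] [Fintype Z] (P : Problem X Y Z) :
    List.TFAE
      [P.AsymptoticallyComputable,
       ∃ R : NNReal, P.AchievableRate R,
       ∀ C ∈ P.chainSetoid.classes, P.ColumnMonochromatic C Set.univ,
       P.PerfectlyComputable] := by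
  tfae_have 1 → 3 := P.columnMonochromatic_of_asymptoticallyComputable
  tfae_have 3 → 2 := fun h => ⟨_, (P.secureCode_of_columnMonochromatic h).achievableRate⟩
  tfae_have 2 → 1 := by
    rintro ⟨R, prot, -, h⟩ ε hε n₀
    obtain ⟨n, hn, hs⟩ := ((eventually_ge_atTop n₀).and (h ε hε)).exists
    exact ⟨n, hn, prot n, hs⟩
  tfae_have 3 → 4 := fun h => ⟨_, (P.secureCode_of_columnMonochromatic h).perfectlySecure⟩
  tfae_have 4 → 3 := P.columnMonochromatic_of_perfectlyComputable
  tfae_finish
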